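/- **Setting.** Let $\mathcal H$ be a finite-dimensional complex Hilbert space, let $H,V,W$ be Hermitian operators on it, $t\in\mathbb R$, $U=e^{-iHt}$, $W(t)=U^\dagger WU$, and let $\rho$ be any density operator. $\Pi^V_v$ and $\Pi_w=\Pi^{W(t)}_w$ denote the orthogonal projectors onto the eigenspaces of $V$ and $W(t)$. Fix eigenvalues $v_1,v_2$ of $V$. For $\ell=1,2$ let a weak measurement of $\Pi^V_{v_\ell}$ be given by finitely many Kraus operators $$K_{j_\ell}=\sqrt{p_{j_\ell}}\,\mathbb 1+g_{j_\ell}\Pi^V_{v_\ell},\qquad p_{j_\ell}>0,\ \sum_{j_\ell}p_{j_\ell}=1,\ g_{j_\ell}\in\mathbb C,\ \sum_{j_\ell}K_{j_\ell}^\dagger K_{j_\ell}=\mathbb 1 .$$ The forward measurement has Kraus operators $\Pi_{w_1}K_{j_1}$ and the reverse measurement has Kraus operators $(\Pi_{w_2}K_{j_2})^\dagger=K_{j_2}^\dagger\Pi_{w_2}$, with $w_1,w_2$ ranging over the eigenvalues of $W(t)$. A measurement with Kraus operators $(L_x)$ leaves a classical register in the state $\sum_x\mathrm{Tr}(L_x\rho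 L_x^\dagger)|x\rangle\langle x|$; $H_{\rm vN}$ and $H_\alpha$ of the forward register (written $VW(t)$) and of the reverse register (written $W(t)V$) are its base-2 von Neumann entropy $-\mathrm{Tr}\,\sigma\log\sigma$ and Rényi entropy $\frac1{1-\alpha}\log\mathrm{Tr}\,\sigma^\alpha$, with $H_1=H_{\rm vN}$ and $H_\infty(\sigma)=-\log p_{\max}(\sigma)$, $p_{\max}$ the greatest eigenvalue. Put $$\tilde A_{\mathbb 1}(v,w,v',w')=\mathrm{Tr}(\Pi_{w'}\Pi^V_{v'}\Pi_w\Pi^V_v),\qquad p(v|w)=\frac{\mathrm{Tr}(\Pi^V_v\Pi_w)}{\mathrm{Tr}\,\Pi_w}.$$ For a real-valued remainder $R=R(j_1,j_2,w_1,w_2)$ define $$\begin{aligned}f_R(v_1,v_2)=\min_{j_1,j_2,w_1,w_2}\Big\{&C_0+\mathrm{Re}(g_{j_1})C_1+\mathrm{Re}(g_{j_2})C_1'+\mathrm{Re}\big(g_{j_1}g_{j_2}\tilde A_{\mathbb 1}(v_1,w_1,v_2,w_2)\big)C_2\\&+|g_{j_1}|^2\tilde A_{\mathbb 1}(v_1,w_1,v_1,w_2)C_2'+|g_{j_2}|^2\tilde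 A_{\mathbb 1}(v_2,w_1,v_2,w_2)C_2''+Q+R\Big\},\end{aligned}$$ where $$C_0=-\log_2\!\big(p_{j_1}p_{j_2}\mathrm{Tr}(\Pi_{w_2})\,\delta_{w_1w_2}\big)\quad(=+\infty\text{ if }w_1\ne w_2),$$ $$C_1=-\frac{2\,p(v_1|w_2)}{\ln2\,\sqrt{p_{j_1}}},\quad C_1'=-\frac{2\,p(v_2|w_2)}{\ln2\,\sqrt{p_{j_2}}},\quad C_2=-\frac{2}{\ln2\,\sqrt{p_{j_1}p_{j_2}}\,\mathrm{Tr}\,\Pi_{w_2}},$$ $$C_2'=-\frac1{\ln2\;p_{j_1}\mathrm{Tr}\,\Pi_{w_2}},\quad C_2''=-\frac1{\ln2\;p_{j_2}\mathrm{Tr}\,\Pi_{w_2}},$$ $$Q=-\frac{2\,p(v_1|w_2)}{\ln2\,\sqrt{p_{j_1}p_{j_2}}}\mathrm{Re}(g_{j_1}g_{j_2}^*)\,\delta_{v_1v_2}+\frac2{\ln2}\Big[\frac{\mathrm{Re}\,g_{j_1}}{\sqrt{p_{j_1}}}p(v_1|w_2)+\frac{\mathrm{Re}\,g_{j_2}}{\sqrt{p_{j_2}}}p(v_2|w_2)\Big]^2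 .$$ **Theorem.** There are absolute constants $\varepsilon_0,K>0$ such that in every such setting in which, for some $\varepsilon\le\varepsilon_0$, $|g_{j_\ell}|\le\varepsilon\sqrt{p_{j_\ell}}$ for $\ell=1,2$ and all $j_\ell$, the following hold. 1. The forward and the reverse Kraus operators define POVMs: $\sum_xL_x^\dagger L_x=\mathbb 1$ for both. 2. (Uncertainty relations with remainder $O(g^2)$.) There is an $R$ with $|R|\le K\varepsilon^2$ everywhere such that $$H_{\rm vN}(VW(t))_\rho+H_{\rm vN}(W(t)V)_\rho\ge f_R(v_1,v_2),\qquad H_\alpha(VW(t))_\rho+H_\beta(W(t)V)_\rho\ge f_R(v_1,v_2)$$ for all $\alpha,\beta\in(0,\infty]$ with $\frac1\alpha+\frac1\beta=2$. 3. (All second-order terms explicit, remainder $O(g^3)$.) There is an $R$ with $|R|\le K\varepsilon^3$ everywhere such that, for $w_1=w_2=w$ and all $j_1,j_2$, the expression in braces equals $$-\log_2\mathrm{Tr}\big(\Pi_{w}K_{j_2}K_{j_1}^\dagger\Pi_{w}K_{j_1}K_{j_2}^\dagger\big),$$ and, if $W$ has a degenerate eigenvalue (as it does when $W$ acts nontrivially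 only on a proper subsystem of a many-body system), both families of inequalities in 2 hold with this $R$. -/

import Mathlib

open scoped ENNReal

noncomputable section

namespace OTOC

/-! ### Entropies (base-2 logarithms) of a state given by a Hermitian matrix -/

section Entropies

variable {n : Type*} [Fintype n] [DecidableEq n]

/-- The von Neumann entropy `-Tr (σ log₂ σ)`. -/
def vonNeumannEntropy (σ : Matrix n n ℂ) : ℝ :=
  -(cfc (fun x : ℝ => x * Real.logb 2 x) σ).trace.re

/-- The min-entropy `-log₂ p_max`, where `p_max` is the greatest eigenvalue of `σ`. -/
def minEntropy (σ : Matrix n n ℂ) : ℝ :=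
  -Real.logb 2 (sSup (spectrum ℝ σ))

/-- The Rényi entropy `(1 - α)⁻¹ log₂ Tr (σ ^ α)` of order `α ∈ (0, ∞]`, with its usual limits
at `α = 1` (von Neumann entropy) and `α = ∞` (min-entropy). -/
def renyiEntropy (α : ℝ≥0∞) (σ : Matrix n n ℂ) : ℝ :=
  if α = 1 then vonNeumannEntropy σ
  else if α = ∞ then minEntropy σ
  else 1 / (1 - α.toReal) * Real.logb 2 (cfc (fun x : ℝ => x ^ α.toReal) σ).trace.re

end Entropies

/-! ### Operators on a finite-dimensional Hilbert space -/

variable {E : Type*} [NormedAddCommGroup E] [InnerProductSpace ℂ E] [FiniteDimensional ℂ E]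

/-- Trace of an operator. -/
def tr (A : E →ₗ[ℂ] E) : ℂ := LinearMap.trace ℂ E A

/-- `ρ` is a density operator: positive semidefinite, of trace one. -/
def IsState (ρ : E →ₗ[ℂ] E) : Prop := ρ.IsPositive ∧ tr ρ = 1

/-- The time-evolution operator `exp (-i H t)` generated by the Hamiltonian `H`. -/
def evolution (H : E →ₗ[ℂ] E) (t : ℝ) : E →ₗ[ℂ] E :=
  (NormedSpace.exp ((-Complex.I * (t : ℂ)) • LinearMap.toContinuousLinearMap H) : E →L[ℂ] E)

/-- The Heisenberg-picture operator `W(t) = U† W U`, with `U = exp (-i H t)`. -/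
def heisenberg (H W : E →ₗ[ℂ] E) (t : ℝ) : E →ₗ[ℂ] E :=
  (evolution H t).adjoint * W * evolution H t

/-- The orthogonal projector `Π^A_a` onto the eigenvalue-`a` eigenspace of `A`. -/
def eigenProj (A : E →ₗ[ℂ] E) (a : ℂ) : E →ₗ[ℂ] E :=
  ((Module.End.eigenspace A a).starProjection : E →L[ℂ] E)

/-- The Kraus operator `√p 𝟙 + g Π` of one outcome of a weak measurement of the projector `P`. -/
def weakKraus (P : E →ₗ[ℂ] E) (p : ℝ) (g : ℂ) : E →ₗ[ℂ] E :=
  ((Real.sqrt p : ℝ) : ℂ) • (1 : E →ₗ[ℂ] E) + g • P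

/-- A weak measurement of the projector `P`, with outcomes `j : J`: `p j` is the probability that
the uncoupled detector yields `j`, and `g j` is the outcome-dependent coupling. -/
structure WeakMeasurement (J : Type*) [Fintype J] (P : E →ₗ[ℂ] E) where
  p : J → ℝ
  g : J → ℂ
  p_pos : ∀ j, 0 < p j
  p_sum : ∑ j, p j = 1
  complete : ∑ j, (weakKraus P (p j) (g j)).adjoint * weakKraus P (p j) (g j) = 1

/-- The Kraus operator of outcome `j`. -/
def WeakMeasurement.kraus {J : Type*} [Fintype J] {P : E →ₗ[ℂ] E} (M : WeakMeasurement J P)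
    (j : J) : E →ₗ[ℂ] E :=
  weakKraus P (M.p j) (M.g j)

/-- `W` has a degenerate eigenvalue. -/
def IsDegenerate (W : E →ₗ[ℂ] E) : Prop :=
  ∃ w : ℂ, 2 ≤ Module.finrank ℂ (Module.End.eigenspace W w)

section Measurements

/-! ### The forward and reverse measurements

Here `Wt` stands for `W(t)`; the outcomes of its strong measurement are its eigenvalues. -/

variable {J : Type*} [Fintype J] {P : E →ₗ[ℂ] E} (Wt : E →ₗ[ℂ] E)

/-- Forward Kraus operators `Π^{W(t)}_w K_j`: first the weak measurement, then the strong one. -/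
def forwardKraus (M : WeakMeasurement J P) (x : J × Module.End.Eigenvalues Wt) : E →ₗ[ℂ] E :=
  eigenProj Wt x.2 * M.kraus x.1

/-- Reverse Kraus operators `(Π^{W(t)}_w K_j)† = K_j† Π^{W(t)}_w`. -/
def reverseKraus (M : WeakMeasurement J P) (x : Module.End.Eigenvalues Wt × J) : E →ₗ[ℂ] E :=
  (eigenProj Wt x.1 * M.kraus x.2).adjoint

/-- The state `∑ₓ Tr (K_x ρ K_x†) |x⟩⟨x|` of the classical register that records the outcome of
the measurement with Kraus operators `K` performed on `ρ`. -/
def registerState {X : Type*} [DecidableEq X] (K : X → E →ₗ[ℂ] E) (ρ : E →ₗ[ℂ] E) :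
    Matrix X X ℂ :=
  Matrix.diagonal fun x => tr (K x * ρ * (K x).adjoint)

open scoped Classical in
/-- `H_vN (V W(t))_ρ`. -/
def forwardVN (M : WeakMeasurement J P) (ρ : E →ₗ[ℂ] E) : ℝ :=
  vonNeumannEntropy (registerState (forwardKraus Wt M) ρ)

open scoped Classical in
/-- `H_vN (W(t) V)_ρ`. -/
def reverseVN (M : WeakMeasurement J P) (ρ : E →ₗ[ℂ] E) : ℝ :=
  vonNeumannEntropy (registerState (reverseKraus Wt M) ρ)

open scoped Classical in
/-- `H_α (V W(t))_ρ`. -/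
def forwardRenyi (α : ℝ≥0∞) (M : WeakMeasurement J P) (ρ : E →ₗ[ℂ] E) : ℝ :=
  renyiEntropy α (registerState (forwardKraus Wt M) ρ)

open scoped Classical in
/-- `H_α (W(t) V)_ρ`. -/
def reverseRenyi (α : ℝ≥0∞) (M : WeakMeasurement J P) (ρ : E →ₗ[ℂ] E) : ℝ :=
  renyiEntropy α (registerState (reverseKraus Wt M) ρ)

end Measurements

section Bound

/-! ### The bound -/

variable (V Wt : E →ₗ[ℂ] E)

/-- The OTOC quasiprobability
`Ã_ρ(v₁, w₁, v₂, w₂) = Tr (Π^{W(t)}_{w₂} Π^V_{v₂} Π^{W(t)}_{w₁} Π^V_{v₁} ρ)`. -/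
def quasiprob (ρ : E →ₗ[ℂ] E) (v₁ w₁ v₂ w₂ : ℂ) : ℂ :=
  tr (eigenProj Wt w₂ * eigenProj V v₂ * eigenProj Wt w₁ * eigenProj V v₁ * ρ)

/-- The trace `Tr Π^{W(t)}_w`. -/
def multiplicity (w : ℂ) : ℝ := (tr (eigenProj Wt w)).re

/-- The conditional probability `p(v|w) = Tr (Π^V_v Π^{W(t)}_w) / Tr Π^{W(t)}_w`. -/
def condProb (v w : ℂ) : ℝ :=
  (tr (eigenProj V v * eigenProj Wt w)).re / multiplicity Wt w

open scoped Classical in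
/-- `C₀ = -log₂ (p₁ p₂ Tr (Π^{W(t)}_{w₂} δ_{w₁ w₂}))`, which is `+∞` when `w₁ ≠ w₂`. -/
def C₀ (p₁ p₂ : ℝ) (w₁ w₂ : ℂ) : EReal :=
  if w₁ = w₂ then ((-Real.logb 2 (p₁ * p₂ * multiplicity Wt w₂) : ℝ) : EReal) else ⊤

/-- Coefficient of a term `Re g_j`: `-(2 / ln 2) p(v|w₂) / √p_j`. -/
def C₁ (p : ℝ) (v w₂ : ℂ) : ℝ :=
  -2 / Real.log 2 * condProb V Wt v w₂ / Real.sqrt p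

/-- Coefficient of `Re (g_{j₁} g_{j₂} Ã(v₁, w₁, v₂, w₂))`. -/
def C₂ (p₁ p₂ : ℝ) (w₂ : ℂ) : ℝ :=
  -2 / (Real.log 2 * Real.sqrt (p₁ * p₂) * multiplicity Wt w₂)

/-- Coefficient of a term `|g_j|² Ã(v, w₁, v, w₂)`. -/
def C₂' (p : ℝ) (w₂ : ℂ) : ℝ :=
  -1 / (Real.log 2 * p * multiplicity Wt w₂)

open scoped Classical in
/-- The second-order terms that contain only classical probabilities. -/
def classicalSecondOrder (v₁ v₂ : ℂ) (p₁ p₂ : ℝ) (g₁ g₂ : ℂ) (w₂ : ℂ) : ℝ :=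
  -2 / (Real.log 2 * Real.sqrt (p₁ * p₂)) * condProb V Wt v₁ w₂ * (g₁ * star g₂).re *
      (if v₁ = v₂ then 1 else 0)
    + 2 / Real.log 2 *
      (g₁.re / Real.sqrt p₁ * condProb V Wt v₁ w₂ + g₂.re / Real.sqrt p₂ * condProb V Wt v₂ w₂) ^ 2

/-- All the terms of first and second order in the couplings. -/
def couplingTerms (v₁ v₂ : ℂ) (p₁ p₂ : ℝ) (g₁ g₂ : ℂ) (w₁ w₂ : ℂ) : ℝ :=
  g₁.re * C₁ V Wt p₁ v₁ w₂
    + g₂.re * C₁ V Wt p₂ v₂ w₂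
    + (g₁ * g₂ * quasiprob V Wt 1 v₁ w₁ v₂ w₂).re * C₂ Wt p₁ p₂ w₂
    + ‖g₁‖ ^ 2 * (quasiprob V Wt 1 v₁ w₁ v₁ w₂).re * C₂' Wt p₁ w₂
    + ‖g₂‖ ^ 2 * (quasiprob V Wt 1 v₂ w₁ v₂ w₂).re * C₂' Wt p₂ w₂
    + classicalSecondOrder V Wt v₁ v₂ p₁ p₂ g₁ g₂ w₂

variable {V}
variable {J₁ J₂ : Type*} [Fintype J₁] [Fintype J₂] {v₁ v₂ : Module.End.Eigenvalues V}
  (M₁ : WeakMeasurement J₁ (eigenProj V v₁)) (M₂ : WeakMeasurement J₂ (eigenProj V v₂))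

/-- The expression under the minimum in the bound, with remainder `r`. -/
def boundTerm (j₁ : J₁) (j₂ : J₂) (w₁ w₂ : Module.End.Eigenvalues Wt) (r : ℝ) : EReal :=
  C₀ Wt (M₁.p j₁) (M₂.p j₂) w₁ w₂
    + ((couplingTerms V Wt v₁ v₂ (M₁.p j₁) (M₂.p j₂) (M₁.g j₁) (M₂.g j₂) w₁ w₂ + r : ℝ) : EReal)

/-- The bound `f(v₁, v₂)` with remainder `R`: the minimum, over all outcomes, of `boundTerm`. -/
def bound (R : J₁ → J₂ → Module.End.Eigenvalues Wt → Module.End.Eigenvalues Wt → ℝ) : EReal :=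
  ⨅ (j₁ : J₁) (j₂ : J₂) (w₁ : Module.End.Eigenvalues Wt) (w₂ : Module.End.Eigenvalues Wt),
    boundTerm Wt M₁ M₂ j₁ j₂ w₁ w₂ (R j₁ j₂ w₁ w₂)

/-- The trace `Tr (Π_{w₂} K_{j₂} K_{j₁}† Π_{w₁} K_{j₁} K_{j₂}†)`. -/
def overlapTrace (j₁ : J₁) (j₂ : J₂) (w₁ w₂ : Module.End.Eigenvalues Wt) : ℝ :=
  (tr (eigenProj Wt w₂ * M₂.kraus j₂ * (M₁.kraus j₁).adjoint * eigenProj Wt w₁ *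
    M₁.kraus j₁ * (M₂.kraus j₂).adjoint)).re

/-- Both uncertainty relations, with the lower bound `f`: for the von Neumann entropies, and for
the Rényi entropies of all orders with `1/α + 1/β = 2`. -/
def UncertaintyRelations (ρ : E →ₗ[ℂ] E) (f : EReal) : Prop :=
  f ≤ ((forwardVN Wt M₁ ρ + reverseVN Wt M₂ ρ : ℝ) : EReal) ∧
  ∀ α β : ℝ≥0∞, α⁻¹ + β⁻¹ = 2 →
    f ≤ ((forwardRenyi Wt α M₁ ρ + reverseRenyi Wt β M₂ ρ : ℝ) : EReal)

end Bound

end OTOC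

end

/-! The uncertainty relations are of Maassen–Uffink type. For measurements `K`, `L` with `∑ K†K = ∑
L†L = 1`, the sum of the two entropies is at least `-log₂ c` as soon as `‖K_x L_y†‖² ≤ c` for all
outcomes (`entropic_uncertainty`). The amplitudes `M x y = Tr(L_y†L_y ρ K_x†K_x)` have the outcome
distributions as marginals and obey a `2 → 2` bound with constant `1` from completeness, and an
entrywise bound with constant `√c`. The three lines theorem interpolates between the two; the von
Neumann case is the derivative at the endpoint where the inequality is trivial, and order `∞` is a
direct estimate.

For the forward and reverse measurements `K_x L_y†` is `Π_{w₁} K_{j₁} Π_{w₂} K_{j₂}`. Each term of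
the bound with `w₁ = w₂ = w` equals `-log₂` of an `effectiveOverlap`, close to `p₁ p₂ Tr Π_w`. It
therefore suffices to dominate every squared norm by some effective overlap
(`uncertaintyRelations_of_normBound`); terms with `w₁ ≠ w₂` are `+∞` and never matter. If `w₁ ≠ w₂`,
orthogonality of the projectors makes the norm carry an extra factor `ε`. If the multiplicity is at
least `2`, the squared norm is about `p₁ p₂` at most, and the trace leaves a factor `2` to spare.
Only multiplicity `1` is tight: the operator then has rank one, its squared norm agrees to first
order with the bound, and a remainder of order `ε²` absorbs the rest. A degenerate eigenvalue has
enough slack to dominate all outcomes at once, so then any sufficiently small remainder works.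

The third claim takes the exact logarithm as definition of the remainder; `exists_tr_overlap_eq` and
the Taylor expansion of the logarithm show that it is of third order. -/

noncomputable section

namespace OTOC

/-! ### Entropies of diagonal states -/

section DiagonalEntropies

variable {X : Type*} [Fintype X] [DecidableEq X]

/-- On the finite spectrum `f` agrees with a Lagrange interpolation polynomial, and polynomials act
entrywise on diagonal matrices. -/
lemma cfc_diagonal_ofReal (f : ℝ → ℝ) (r : X → ℝ) :
    cfc f (Matrix.diagonal fun x => (r x : ℂ)) = Matrix.diagonal fun x => (f (r x) : ℂ) := by
  have hsa : IsSelfAdjoint (Matrix.diagonal fun x => (r x : ℂ)) := by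
    rw [IsSelfAdjoint, Matrix.star_eq_conjTranspose, Matrix.diagonal_conjTranspose]
    congr 1
    ext x
    simp
  have hspec : spectrum ℝ (Matrix.diagonal fun x => (r x : ℂ)) ⊆ Set.range r := by
    intro z hz
    rw [← spectrum.algebraMap_mem_iff ℂ, spectrum_diagonal] at hz
    obtain ⟨x, hx⟩ := hz
    exact ⟨x, by simpa using hx⟩
  let s : Finset ℝ := Finset.univ.image r
  let p : Polynomial ℝ := Lagrange.interpolate s id f
  have hp : ∀ x, p.eval (r x) = f (r x) := fun x =>
    Lagrange.eval_interpolate_at_node (s := s) (v := id) f (Set.injOn_id _)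
      (Finset.mem_image_of_mem r (Finset.mem_univ x))
  have h1 : cfc f (Matrix.diagonal fun x => (r x : ℂ))
      = cfc p.eval (Matrix.diagonal fun x => (r x : ℂ)) := by
    refine cfc_congr fun z hz => ?_
    obtain ⟨x, rfl⟩ := hspec hz
    exact (hp x).symm
  rw [h1, cfc_polynomial p _ hsa]
  have h2 := Polynomial.aeval_algHom_apply (Matrix.diagonalAlgHom (n := X) (α := ℂ) ℝ)
    (fun x => (r x : ℂ)) p
  simp only [Matrix.diagonalAlgHom_apply] at h2
  rw [h2]
  congr 1
  ext x
  rw [← hp x]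
  have := Polynomial.aeval_algHom_apply (Pi.evalAlgHom ℝ (fun _ : X => ℂ) x)
    (fun x => (r x : ℂ)) p
  simp only [Pi.evalAlgHom_apply] at this
  rw [← this]
  exact Polynomial.aeval_algebraMap_apply_eq_algebraMap_eval (A := ℂ) (r x) p

lemma spectrum_real_diagonal (r : X → ℝ) :
    spectrum ℝ (Matrix.diagonal fun x => (r x : ℂ)) = Set.range r := by
  ext z
  rw [← spectrum.algebraMap_mem_iff ℂ, spectrum_diagonal]
  simp

lemma vonNeumannEntropy_diagonal (r : X → ℝ) :
    vonNeumannEntropy (Matrix.diagonal fun x => (r x : ℂ))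
      = -∑ x, r x * Real.logb 2 (r x) := by
  rw [vonNeumannEntropy, cfc_diagonal_ofReal, Matrix.trace_diagonal]
  simp only [← Complex.ofReal_sum, Complex.ofReal_re]

lemma trace_cfc_rpow_diagonal (r : X → ℝ) (a : ℝ) :
    (cfc (fun x : ℝ => x ^ a) (Matrix.diagonal fun x => (r x : ℂ))).trace.re
      = ∑ x, r x ^ a := by
  rw [cfc_diagonal_ofReal, Matrix.trace_diagonal]
  simp only [← Complex.ofReal_sum, Complex.ofReal_re]

end DiagonalEntropies

/-! ### Interpolation for joint amplitudes -/

section Interpolation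

open Complex

variable {X Y : Type*} [Fintype X] [Fintype Y]

/-- Joint amplitudes `M x y` of two measurements with outcome distributions `r` and `q`,
of overlap at most `c`. -/
structure IsOverlap (r : X → ℝ) (q : Y → ℝ) (M : X → Y → ℂ) (c : ℝ) : Prop where
  r_nonneg : ∀ x, 0 ≤ r x
  q_nonneg : ∀ y, 0 ≤ q y
  r_sum : ∑ x, r x = 1
  q_sum : ∑ y, q y = 1
  c_pos : 0 < c
  sum_right : ∀ x, ∑ y, M x y = r x
  sum_left : ∀ y, ∑ x, M x y = q y
  norm_le : ∀ x y, ‖M x y‖ ≤ √c * √(r x) * √(q y)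
  norm_sum_le : ∀ (u : X → ℂ) (v : Y → ℂ),
    ‖∑ x, ∑ y, u x * v y * M x y‖ ≤ √(∑ x, ‖u x‖ ^ 2 * r x) * √(∑ y, ‖v y‖ ^ 2 * q y)

lemma IsOverlap.swap {r : X → ℝ} {q : Y → ℝ} {M : X → Y → ℂ} {c : ℝ} (h : IsOverlap r q M c) :
    IsOverlap q r (fun y x => M x y) c where
  r_nonneg := h.q_nonneg
  q_nonneg := h.r_nonneg
  r_sum := h.q_sum
  q_sum := h.r_sum
  c_pos := h.c_pos
  sum_right := h.sum_left
  sum_left := h.sum_right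
  norm_le y x := (h.norm_le x y).trans_eq (by ring)
  norm_sum_le u v := by
    rw [Finset.sum_comm, mul_comm]
    simpa only [mul_comm (u _) (v _)] using h.norm_sum_le v u

lemma exp_mul_log_eq_rpow {r : ℝ} (hr : 0 < r) (s : ℝ) : Real.exp (s * Real.log r) = r ^ s := by
  rw [Real.rpow_def_of_pos hr, mul_comm]

lemma sum_rpow_pos {r : X → ℝ} (hr : ∀ x, 0 ≤ r x) (hs : ∑ x, r x = 1) (a : ℝ) :
    0 < ∑ x, r x ^ a := by
  obtain ⟨x, -, hx⟩ : ∃ x ∈ Finset.univ, r x ≠ 0 := by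
    apply Finset.exists_ne_zero_of_sum_ne_zero
    rw [hs]; exact one_ne_zero
  exact Finset.sum_pos' (fun x _ => Real.rpow_nonneg (hr x) a)
    ⟨x, Finset.mem_univ x, Real.rpow_pos_of_pos (lt_of_le_of_ne (hr x) hx.symm) a⟩

/-- The exponential form is entire in the exponent. At `r = 0`, where `Real.log 0 = 0`, the
exponential is `1`, but the remaining factor `r` vanishes, so no positivity of `r` is needed here or
in the two variants below. -/
lemma exp_log_sq_mul {r a : ℝ} (hr : 0 ≤ r) (ha : 0 < a) :
    Real.exp ((a - 1) / 2 * Real.log r) ^ 2 * r = r ^ a := by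
  rcases hr.eq_or_lt with rfl | hr
  · simp [Real.zero_rpow ha.ne']
  · rw [exp_mul_log_eq_rpow hr, ← Real.rpow_natCast, ← Real.rpow_mul hr.le]
    nth_rw 2 [← Real.rpow_one r]
    rw [← Real.rpow_add hr]
    congr 1; push_cast; ring

lemma exp_log_mul_sqrt {r a : ℝ} (hr : 0 ≤ r) (ha : 0 < a) :
    Real.exp ((a - 1 / 2) * Real.log r) * √r = r ^ a := by
  rcases hr.eq_or_lt with rfl | hr
  · simp [Real.zero_rpow ha.ne']
  · rw [exp_mul_log_eq_rpow hr, Real.sqrt_eq_rpow, ← Real.rpow_add hr]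
    congr 1; ring

lemma exp_log_mul {r a : ℝ} (hr : 0 ≤ r) (ha : 0 < a) :
    Real.exp ((a - 1) * Real.log r) * r = r ^ a := by
  rcases hr.eq_or_lt with rfl | hr
  · simp [Real.zero_rpow ha.ne']
  · rw [exp_mul_log_eq_rpow hr]
    nth_rw 2 [← Real.rpow_one r]
    rw [← Real.rpow_add hr]
    congr 1; ring

/-- Riesz–Thorin interpolation between the `2 → 2` and the `1 → ∞` bound. -/
lemma IsOverlap.interpolation {r : X → ℝ} {q : Y → ℝ} {M : X → Y → ℂ} {c : ℝ}
    (h : IsOverlap r q M c) {θ a b : ℝ} (h0 : 0 < θ) (h1 : θ < 1) (ha : a * (1 - θ) = 1)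
    (hb : b * (1 + θ) = 1) :
    ∑ x, r x ^ a ≤ (√(∑ x, r x ^ a) * √(∑ y, q y ^ b)) ^ (1 - θ)
      * (√c * (∑ x, r x ^ a) * (∑ y, q y ^ b)) ^ θ := by
  have ha0 : 0 < a := by
    by_contra hn
    nlinarith
  have hb0 : 0 < b := by
    by_contra hn
    nlinarith
  -- Informally `u z = r ^ ((a - 1 + z a) / 2)` and `v z = q ^ ((b - 1 + z b) / 2)`. At `z = θ` the
  -- relations of `a`, `b` with `θ` turn these into `r ^ (a - 1)` and `1`.
  let u : ℂ → X → ℂ := fun z x => cexp ((((a - 1) / 2 : ℝ) + z * (a / 2 : ℝ)) * (Real.log (r x) : ℝ))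
  let v : ℂ → Y → ℂ := fun z y => cexp ((((b - 1) / 2 : ℝ) + z * (b / 2 : ℝ)) * (Real.log (q y) : ℝ))
  let F : ℂ → ℂ := fun z => ∑ x, ∑ y, u z x * v z y * M x y
  have hu : ∀ z x, ‖u z x‖ = Real.exp (((a - 1) / 2 + z.re * (a / 2)) * Real.log (r x)) := by
    intro z x
    simp only [u, Complex.norm_exp]
    congr 1
    simp [-Complex.ofReal_div, -Complex.ofReal_sub]
  have hv : ∀ z y, ‖v z y‖ = Real.exp (((b - 1) / 2 + z.re * (b / 2)) * Real.log (q y)) := by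
    intro z x
    simp only [v, Complex.norm_exp]
    congr 1
    simp [-Complex.ofReal_div, -Complex.ofReal_sub]
  have hFd : Differentiable ℂ F := by
    simp only [F, u, v]
    fun_prop
  have hexp : ∀ s t L x : ℝ, 0 ≤ x → x ≤ 1 →
      (s + x * t) * L ≤ |s * L| + |t * L| := by
    intro s t L x hx0 hx1
    have h1 := le_abs_self (s * L)
    have h2 : x * (t * L) ≤ 1 * |t * L| :=
      (mul_le_mul_of_nonneg_left (le_abs_self _) hx0).trans
        (mul_le_mul_of_nonneg_right hx1 (abs_nonneg _))
    nlinarith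
  have hB : BddAbove ((norm ∘ F) '' HadamardThreeLines.verticalClosedStrip 0 1) := by
    refine ⟨∑ x, ∑ y, Real.exp (|(a - 1) / 2 * Real.log (r x)| + |a / 2 * Real.log (r x)|)
      * Real.exp (|(b - 1) / 2 * Real.log (q y)| + |b / 2 * Real.log (q y)|) * ‖M x y‖, ?_⟩
    rintro _ ⟨z, hz, rfl⟩
    have hz' : z.re ∈ Set.Icc (0 : ℝ) 1 := hz
    simp only [Function.comp, F]
    refine (_root_.norm_sum_le _ _).trans (Finset.sum_le_sum fun x _ =>
      (_root_.norm_sum_le _ _).trans (Finset.sum_le_sum fun y _ => ?_))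
    rw [norm_mul, norm_mul, hu, hv]
    gcongr
    · exact hexp _ _ _ _ hz'.1 hz'.2
    · exact hexp _ _ _ _ hz'.1 hz'.2
  -- On the left edge the weighted `ℓ²` norms of `u` and `v` give exactly the power sums.
  have hl : ∀ z ∈ re ⁻¹' {(0 : ℝ)}, ‖F z‖ ≤ √(∑ x, r x ^ a) * √(∑ y, q y ^ b) := by
    intro z hz
    have hz' : z.re = 0 := hz
    refine (h.norm_sum_le (u z) (v z)).trans_eq ?_
    simp only [hu, hv, hz', zero_mul, add_zero, exp_log_sq_mul (h.r_nonneg _) ha0,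
      exp_log_sq_mul (h.q_nonneg _) hb0]
  -- On the right edge the entrywise bound supplies the half powers that complete `|u|` and `|v|` to
  -- `r ^ a` and `q ^ b`.
  have hr : ∀ z ∈ re ⁻¹' {(1 : ℝ)}, ‖F z‖ ≤ √c * (∑ x, r x ^ a) * (∑ y, q y ^ b) := by
    intro z hz
    have hz' : z.re = 1 := hz
    have e1 : ∀ x, r x ^ a = ‖u z x‖ * √(r x) := by
      intro x
      rw [← exp_log_mul_sqrt (h.r_nonneg x) ha0, hu, hz']
      congr 3; ring
    have e2 : ∀ y, q y ^ b = ‖v z y‖ * √(q y) := by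
      intro x
      rw [← exp_log_mul_sqrt (h.q_nonneg x) hb0, hv, hz']
      congr 3; ring
    rw [mul_assoc, Finset.sum_mul_sum, Finset.mul_sum]
    simp only [F]
    refine (_root_.norm_sum_le _ _).trans (Finset.sum_le_sum fun x _ => ?_)
    rw [Finset.mul_sum]
    refine (_root_.norm_sum_le _ _).trans (Finset.sum_le_sum fun y _ => ?_)
    rw [norm_mul, norm_mul, e1, e2]
    calc ‖u z x‖ * ‖v z y‖ * ‖M x y‖ ≤ ‖u z x‖ * ‖v z y‖ * (√c * √(r x) * √(q y)) := by
          gcongr; exact h.norm_le x y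
      _ = _ := by ring
  have key := HadamardThreeLines.norm_le_interp_of_mem_verticalClosedStrip' (f := F)
    (z := (θ : ℂ)) zero_lt_one (show (θ : ℂ).re ∈ Set.Icc (0 : ℝ) 1 from ⟨h0.le, h1.le⟩)
    hFd.diffContOnCl hB hl hr
  simp only [ofReal_re, sub_zero, div_one] at key
  -- Since `v θ = 1`, summing over `y` leaves the marginal `r`.
  have hF : F θ = ((∑ x, r x ^ a : ℝ) : ℂ) := by
    have hv1 : ∀ y, v θ y = 1 := by
      intro y
      have : (((b - 1) / 2 : ℝ) : ℂ) + (θ : ℂ) * (b / 2 : ℝ) = 0 := by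
        rw [← Complex.ofReal_mul, ← Complex.ofReal_add, Complex.ofReal_eq_zero]
        linarith
      simp only [v, this, zero_mul, Complex.exp_zero]
    simp only [F, hv1, mul_one, ← Finset.mul_sum, h.sum_right]
    rw [Complex.ofReal_sum]
    refine Finset.sum_congr rfl fun x _ => ?_
    rw [← exp_log_mul (h.r_nonneg x) ha0]
    simp only [u]
    rw [← Complex.ofReal_mul, ← Complex.ofReal_add, ← Complex.ofReal_mul, ← Complex.ofReal_exp,
      ← Complex.ofReal_mul]
    congr 4
    linarith
  rwa [hF, Complex.norm_real, Real.norm_of_nonneg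
    (Finset.sum_nonneg fun x _ => Real.rpow_nonneg (h.r_nonneg x) a)] at key

/-- In the logarithm of the interpolation bound, `(1 + θ) / 2` of `log ∑ r ^ a` on the right cancels
against the left side; the result is then doubled. -/
lemma IsOverlap.log_sum_rpow_le {r : X → ℝ} {q : Y → ℝ} {M : X → Y → ℂ} {c : ℝ}
    (h : IsOverlap r q M c) {θ a b : ℝ} (h0 : 0 < θ) (h1 : θ < 1) (ha : a * (1 - θ) = 1)
    (hb : b * (1 + θ) = 1) :
    (1 - θ) * Real.log (∑ x, r x ^ a)
      ≤ θ * Real.log c + (1 + θ) * Real.log (∑ y, q y ^ b) := by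
  have hA := sum_rpow_pos h.r_nonneg h.r_sum a
  have hB := sum_rpow_pos h.q_nonneg h.q_sum b
  have key := Real.log_le_log hA (h.interpolation h0 h1 ha hb)
  have hc := h.c_pos
  rw [Real.log_mul (by positivity) (by positivity), Real.log_rpow (by positivity),
    Real.log_rpow (by positivity), Real.log_mul (by positivity) (by positivity),
    Real.log_mul (by positivity) (by positivity), Real.log_mul (by positivity) (by positivity),
    Real.log_sqrt hA.le, Real.log_sqrt hB.le, Real.log_sqrt hc.le] at key
  linarith

lemma hasDerivAt_log_sum_rpow {r : X → ℝ} (hr : ∀ x, 0 ≤ r x) (hs : ∑ x, r x = 1) :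
    HasDerivAt (fun a : ℝ => Real.log (∑ x, r x ^ a)) (∑ x, r x * Real.log (r x)) 1 := by
  have h1 : HasDerivAt (fun a : ℝ => ∑ x, r x ^ a) (∑ x, r x * Real.log (r x)) 1 := by
    refine HasDerivAt.fun_sum fun x _ => ?_
    rcases (hr x).eq_or_lt with h0 | h0
    · rw [← h0]
      simp only [Real.log_zero, mul_zero]
      -- A vanishing probability contributes `0 ^ a`, which is `0` for all `a` near `1`.
      refine (hasDerivAt_const (1 : ℝ) (0 : ℝ)).congr_of_eventuallyEq ?_
      filter_upwards [lt_mem_nhds (zero_lt_one : (0 : ℝ) < 1)] with a ha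
      exact Real.zero_rpow ha.ne'
    · have := (Real.hasStrictDerivAt_const_rpow h0 1).hasDerivAt
      simpa using this
  have h2 := h1.log (by simp [hs])
  simpa [hs] using h2

/-- The gap `G θ` in the logarithmic inequality is nonnegative on `(0, 1)` and vanishes at `0`, so
its derivative at `0` is nonnegative; that derivative is the claim. -/
lemma IsOverlap.shannon {r : X → ℝ} {q : Y → ℝ} {M : X → Y → ℂ} {c : ℝ}
    (h : IsOverlap r q M c) :
    -Real.log c ≤ -(∑ x, r x * Real.log (r x)) - ∑ y, q y * Real.log (q y) := by
  let G : ℝ → ℝ := fun θ => θ * Real.log c + (1 + θ) * Real.log (∑ y, q y ^ (1 + θ)⁻¹)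
    - (1 - θ) * Real.log (∑ x, r x ^ (1 - θ)⁻¹)
  have hq := hasDerivAt_log_sum_rpow h.q_nonneg h.q_sum
  have hr := hasDerivAt_log_sum_rpow h.r_nonneg h.r_sum
  have d1 : HasDerivAt (fun θ : ℝ => 1 + θ) 1 0 := (hasDerivAt_id (0 : ℝ)).const_add 1
  have d2 : HasDerivAt (fun θ : ℝ => 1 - θ) (-1) 0 := (hasDerivAt_id (0 : ℝ)).const_sub 1
  have e1 : HasDerivAt (fun θ : ℝ => (1 + θ)⁻¹) (-1) 0 := by
    simpa using d1.fun_inv (by norm_num)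
  have e2 : HasDerivAt (fun θ : ℝ => (1 - θ)⁻¹) 1 0 := by
    simpa using d2.fun_inv (by norm_num)
  have f1 := HasDerivAt.comp (0 : ℝ) (h := fun θ : ℝ => (1 + θ)⁻¹)
    (h₂ := fun a : ℝ => Real.log (∑ y, q y ^ a)) (by simpa using hq) e1
  have f2 := HasDerivAt.comp (0 : ℝ) (h := fun θ : ℝ => (1 - θ)⁻¹)
    (h₂ := fun a : ℝ => Real.log (∑ x, r x ^ a)) (by simpa using hr) e2
  have hG : HasDerivAt G (Real.log c - (∑ y, q y * Real.log (q y))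
      - ∑ x, r x * Real.log (r x)) 0 := by
    have := (((hasDerivAt_id (0 : ℝ)).mul_const (Real.log c)).add (d1.mul f1)).sub (d2.mul f2)
    refine this.congr_deriv ?_
    simp [h.r_sum, h.q_sum]
    ring
  have hG0 : G 0 = 0 := by simp [G, h.r_sum, h.q_sum]
  have hlim := (hasDerivWithinAt_iff_tendsto_slope' (s := Set.Ioi (0 : ℝ)) (by simp)).1
    hG.hasDerivWithinAt
  have hnn : 0 ≤ Real.log c - (∑ y, q y * Real.log (q y)) - ∑ x, r x * Real.log (r x) := by
    refine ge_of_tendsto hlim ?_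
    filter_upwards [Ioo_mem_nhdsGT (zero_lt_one : (0 : ℝ) < 1)] with θ hθ
    rw [slope_def_field, hG0]
    have := h.log_sum_rpow_le hθ.1 hθ.2 (a := (1 - θ)⁻¹) (b := (1 + θ)⁻¹)
      (inv_mul_cancel₀ (by linarith [hθ.2])) (inv_mul_cancel₀ (by linarith [hθ.1]))
    have : 0 ≤ G θ := by simp only [G]; linarith
    have := hθ.1
    simp only [sub_zero]
    positivity
  linarith

/-- The endpoint `α = ∞`, `β = 1/2`: write `r x` as `∑ y, M x y`, apply the entrywise bound and
cancel one factor `√(r x)`. -/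
lemma IsOverlap.sqrt_le {r : X → ℝ} {q : Y → ℝ} {M : X → Y → ℂ} {c : ℝ}
    (h : IsOverlap r q M c) (x : X) : √(r x) ≤ √c * ∑ y, √(q y) := by
  have h1 : r x ≤ √(r x) * (√c * ∑ y, √(q y)) := by
    have : ‖((r x : ℝ) : ℂ)‖ = r x := by
      rw [Complex.norm_real, Real.norm_of_nonneg (h.r_nonneg x)]
    rw [← this, ← h.sum_right x, Finset.mul_sum, Finset.mul_sum]
    refine (_root_.norm_sum_le _ _).trans (Finset.sum_le_sum fun y _ => (h.norm_le x y).trans_eq ?_)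
    rw [h.sum_right, this]
    ring
  rcases (Real.sqrt_nonneg (r x)).eq_or_lt with h0 | h0
  · rw [← h0]
    exact mul_nonneg (Real.sqrt_nonneg _) (Finset.sum_nonneg fun _ _ => Real.sqrt_nonneg _)
  · refine le_of_mul_le_mul_left ?_ h0
    rwa [Real.mul_self_sqrt (h.r_nonneg x)]

end Interpolation

/-! ### Rényi and von Neumann uncertainty relations for distributions -/

section EntropicBounds

variable {X Y : Type*} [Fintype X] [Fintype Y] [DecidableEq X] [DecidableEq Y]
  {r : X → ℝ} {q : Y → ℝ} {M : X → Y → ℂ} {c : ℝ}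

lemma IsOverlap.vonNeumannEntropy_add_le (h : IsOverlap r q M c) :
    -Real.logb 2 c ≤ vonNeumannEntropy (Matrix.diagonal fun x => (r x : ℂ))
      + vonNeumannEntropy (Matrix.diagonal fun y => (q y : ℂ)) := by
  have h2 : 0 < Real.log 2 := Real.log_pos one_lt_two
  have := h.shannon
  rw [vonNeumannEntropy_diagonal, vonNeumannEntropy_diagonal]
  simp only [Real.logb, ← mul_div_assoc, ← Finset.sum_div]
  rw [← neg_div, ← neg_div, ← neg_div, ← add_div]
  gcongr
  linarith

lemma IsOverlap.renyiEntropy_top_add_le (h : IsOverlap r q M c) :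
    -Real.logb 2 c ≤ renyiEntropy ∞ (Matrix.diagonal fun x => (r x : ℂ))
      + renyiEntropy 2⁻¹ (Matrix.diagonal fun y => (q y : ℂ)) := by
  have h2 : 0 < Real.log 2 := Real.log_pos one_lt_two
  have hX : Nonempty X := by
    by_contra hX
    rw [not_nonempty_iff] at hX
    simpa using h.r_sum
  obtain ⟨x, hx⟩ := Finite.exists_max r
  have hsup : sSup (Set.range r) = r x :=
    le_antisymm (csSup_le (Set.range_nonempty r) (by rintro _ ⟨y, rfl⟩; exact hx y))
      (le_csSup ⟨r x, by rintro _ ⟨y, rfl⟩; exact hx y⟩ ⟨x, rfl⟩)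
  have hne1 : (2⁻¹ : ℝ≥0∞) ≠ 1 := by simp
  have hne2 : (2⁻¹ : ℝ≥0∞) ≠ ∞ := by simp
  rw [renyiEntropy, if_neg (by simp), if_pos rfl, renyiEntropy, if_neg hne1, if_neg hne2,
    minEntropy, spectrum_real_diagonal, hsup, trace_cfc_rpow_diagonal]
  have hpos : 0 < r x := by
    refine lt_of_le_of_ne (h.r_nonneg x) fun h0 => ?_
    have : ∑ x, r x ≤ 0 := Finset.sum_nonpos fun y _ => (hx y).trans_eq h0.symm
    rw [h.r_sum] at this
    linarith
  have hB := sum_rpow_pos h.q_nonneg h.q_sum (1 / 2)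
  have key := h.sqrt_le x
  simp only [Real.sqrt_eq_rpow (q _)] at key
  have hc := h.c_pos
  have := Real.log_le_log (by positivity) key
  rw [Real.log_mul (by positivity) (by positivity), Real.log_sqrt hc.le, Real.log_sqrt hpos.le]
    at this
  have e : (2⁻¹ : ℝ≥0∞).toReal = 1 / 2 := by simp
  rw [e]
  simp only [Real.logb]
  rw [← neg_div, ← neg_div, ← mul_div_assoc, ← add_div]
  gcongr
  norm_num
  linarith

lemma IsOverlap.renyiEntropy_add_le_of_one_lt (h : IsOverlap r q M c) {α β : ℝ≥0∞}
    (hαβ : α⁻¹ + β⁻¹ = 2) (h1 : 1 < α) :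
    -Real.logb 2 c ≤ renyiEntropy α (Matrix.diagonal fun x => (r x : ℂ))
      + renyiEntropy β (Matrix.diagonal fun y => (q y : ℂ)) := by
  have h2 : 0 < Real.log 2 := Real.log_pos one_lt_two
  by_cases hα : α = ∞
  · subst hα
    have : β = 2⁻¹ := by
      rw [ENNReal.inv_top, zero_add] at hαβ
      rw [← hαβ, inv_inv]
    rw [this]
    exact h.renyiEntropy_top_add_le
  have hβ0 : β ≠ 0 := by
    rintro rfl
    simp at hαβ
  have hβt : β ≠ ∞ := by
    rintro rfl
    rw [ENNReal.inv_top, add_zero] at hαβ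
    have : α⁻¹ < 1 := ENNReal.inv_lt_one.2 h1
    rw [hαβ] at this
    exact absurd this (by norm_num)
  have hα0 : α ≠ 0 := (zero_lt_one.trans h1).ne'
  obtain ⟨a, ha⟩ : ∃ a, a = α.toReal := ⟨_, rfl⟩
  obtain ⟨b, hb⟩ : ∃ b, b = β.toReal := ⟨_, rfl⟩
  have ha1 : 1 < a := by
    rw [ha]
    have := (ENNReal.toReal_lt_toReal ENNReal.one_ne_top hα).2 h1
    simpa using this
  have hb0 : 0 < b := by rw [hb]; exact ENNReal.toReal_pos hβ0 hβt
  have hab : a⁻¹ + b⁻¹ = 2 := by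
    have := congrArg ENNReal.toReal hαβ
    rw [ENNReal.toReal_add (ENNReal.inv_ne_top.2 hα0) (ENNReal.inv_ne_top.2 hβ0),
      ENNReal.toReal_inv, ENNReal.toReal_inv, ← ha, ← hb] at this
    simpa using this
  have ha' : a⁻¹ < 1 := inv_lt_one_of_one_lt₀ ha1
  have ha'' : 0 < a⁻¹ := by positivity
  have hbne : b ≠ 1 := by
    rintro rfl
    norm_num at hab
    linarith
  have hβ1 : β ≠ 1 := by
    rintro rfl
    exact hbne (by simp [hb])
  rw [renyiEntropy, if_neg h1.ne', if_neg hα, renyiEntropy, if_neg hβ1, if_neg hβt,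
    trace_cfc_rpow_diagonal, trace_cfc_rpow_diagonal, ← ha, ← hb]
  have hθ : 0 < 1 - a⁻¹ := by linarith
  -- With `θ = 1 - 1/α` the constraint on the orders reads `1/β = 1 + θ`; dividing by `θ` produces
  -- the two Rényi prefactors.
  have key := h.log_sum_rpow_le (θ := 1 - a⁻¹) (a := a) (b := b) hθ (by linarith)
    (by rw [sub_sub_cancel]; exact mul_inv_cancel₀ (by positivity))
    (by rw [show 1 + (1 - a⁻¹) = b⁻¹ by linarith]; exact mul_inv_cancel₀ hb0.ne')
  rw [sub_sub_cancel, show 1 + (1 - a⁻¹) = b⁻¹ by linarith] at key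
  have e1 : 1 / (1 - a) = -(a⁻¹ / (1 - a⁻¹)) := by
    have : 1 - a ≠ 0 := by linarith
    have : a - 1 ≠ 0 := by linarith
    field_simp
    ring
  have e2 : 1 / (1 - b) = b⁻¹ / (1 - a⁻¹) := by
    rw [show 1 - a⁻¹ = b⁻¹ - 1 by linarith]
    have : 1 - b ≠ 0 := fun h => hbne (by linarith)
    field_simp
  rw [e1, e2]
  simp only [Real.logb]
  rw [← neg_div, ← mul_div_assoc, ← mul_div_assoc, ← add_div]
  gcongr
  rw [neg_le_iff_add_nonneg]
  have : 0 ≤ ((1 - a⁻¹) * Real.log c + b⁻¹ * Real.log (∑ y, q y ^ b)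
      - a⁻¹ * Real.log (∑ x, r x ^ a)) / (1 - a⁻¹) := div_nonneg (by linarith) hθ.le
  rw [sub_div, add_div, mul_div_cancel_left₀ _ hθ.ne', mul_div_right_comm, mul_div_right_comm]
    at this
  linarith

/-- Unless both orders are `1`, exactly one exceeds `1`, and the hypotheses are symmetric in the two
measurements. -/
lemma IsOverlap.renyiEntropy_add_le (h : IsOverlap r q M c) {α β : ℝ≥0∞}
    (hαβ : α⁻¹ + β⁻¹ = 2) :
    -Real.logb 2 c ≤ renyiEntropy α (Matrix.diagonal fun x => (r x : ℂ))
      + renyiEntropy β (Matrix.diagonal fun y => (q y : ℂ)) := by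
  rcases lt_trichotomy α 1 with h1 | rfl | h1
  · have h1' : 1 < β := by
      by_contra hβ
      have e1 : 1 < α⁻¹ := ENNReal.one_lt_inv.2 h1
      have e2 : 1 ≤ β⁻¹ := ENNReal.one_le_inv.2 (not_lt.1 hβ)
      have := ENNReal.add_lt_add_of_lt_of_le ENNReal.one_ne_top e1 e2
      rw [hαβ] at this
      norm_num at this
    rw [add_comm]
    exact h.swap.renyiEntropy_add_le_of_one_lt (by rw [add_comm]; exact hαβ) h1'
  · have : β = 1 := by
      rw [inv_one, show (2 : ℝ≥0∞) = 1 + 1 by norm_num] at hαβ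
      have := (ENNReal.add_right_inj ENNReal.one_ne_top).1 hαβ
      simpa using this
    subst this
    simpa only [renyiEntropy, if_true] using h.vonNeumannEntropy_add_le
  · exact h.renyiEntropy_add_le_of_one_lt hαβ h1

end EntropicBounds

section

variable {E : Type*} [NormedAddCommGroup E] [InnerProductSpace ℂ E]

/-! ### Uncertainty relations for Kraus measurements -/

section EntropicUncertainty

open scoped InnerProductSpace

lemma tr_mul_comm (A B : E →ₗ[ℂ] E) : tr (A * B) = tr (B * A) :=
  LinearMap.trace_mul_comm ℂ A B

variable {X Y ι : Type*} [Fintype ι]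

lemma norm_sum_inner_le (a b : ι → E) :
    ‖∑ i, ⟪a i, b i⟫_ℂ‖ ≤ √(∑ i, ‖a i‖ ^ 2) * √(∑ i, ‖b i‖ ^ 2) := by
  have := norm_inner_le_norm (𝕜 := ℂ) (WithLp.toLp 2 a : PiLp 2 fun _ : ι => E) (WithLp.toLp 2 b)
  simpa [PiLp.inner_apply, PiLp.norm_eq_of_L2] using this

variable [FiniteDimensional ℂ E]

lemma registerState_eq_diagonal [DecidableEq X] {ρ : E →ₗ[ℂ] E} {ψ : ι → E}
    (hψ : ∀ A : E →ₗ[ℂ] E, tr (A * ρ) = ∑ i, ⟪ψ i, A (ψ i)⟫_ℂ) (K : X → E →ₗ[ℂ] E) :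
    registerState K ρ = Matrix.diagonal fun x => ((∑ i, ‖K x (ψ i)‖ ^ 2 : ℝ) : ℂ) := by
  unfold registerState
  congr 1
  ext x
  rw [tr_mul_comm, ← mul_assoc, hψ, Complex.ofReal_sum]
  refine Finset.sum_congr rfl fun i _ => ?_
  rw [Module.End.mul_apply, LinearMap.adjoint_inner_right, inner_self_eq_norm_sq_to_K]
  simp

/-- The `ψ i` are eigenvectors of `ρ` scaled by the square roots of their eigenvalues. This family
plays the role of a purification. -/
lemma IsState.exists_ensemble {ρ : E →ₗ[ℂ] E} (hρ : IsState ρ) :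
    ∃ ψ : Fin (Module.finrank ℂ E) → E,
      ∀ A : E →ₗ[ℂ] E, tr (A * ρ) = ∑ i, ⟪ψ i, A (ψ i)⟫_ℂ := by
  have hs := hρ.1.isSymmetric
  refine ⟨fun i => ((√(hs.eigenvalues rfl i) : ℝ) : ℂ) • hs.eigenvectorBasis rfl i, fun A => ?_⟩
  rw [tr, LinearMap.trace_eq_sum_inner _ (hs.eigenvectorBasis rfl)]
  refine Finset.sum_congr rfl fun i _ => ?_
  have h0 : 0 ≤ hs.eigenvalues rfl i := hρ.1.nonneg_eigenvalues rfl i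
  rw [Module.End.mul_apply, hs.apply_eigenvectorBasis, map_smul, map_smul, inner_smul_left,
    inner_smul_right, inner_smul_right, ← mul_assoc, Complex.conj_ofReal, ← Complex.ofReal_mul,
    Real.mul_self_sqrt h0]
  rfl

variable [Fintype X] [Fintype Y]

lemma sum_norm_kraus_sq {K : X → E →ₗ[ℂ] E} (hK : ∑ x, (K x).adjoint * K x = 1) (φ : E) :
    ∑ x, ‖K x φ‖ ^ 2 = ‖φ‖ ^ 2 := by
  have h1 : ∀ x, ((‖K x φ‖ ^ 2 : ℝ) : ℂ) = ⟪φ, ((K x).adjoint * K x) φ⟫_ℂ := by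
    intro x
    rw [Module.End.mul_apply, LinearMap.adjoint_inner_right, inner_self_eq_norm_sq_to_K]
    simp
  have h2 : ((∑ x, ‖K x φ‖ ^ 2 : ℝ) : ℂ) = ((‖φ‖ ^ 2 : ℝ) : ℂ) := by
    rw [Complex.ofReal_sum]
    simp only [h1]
    rw [← inner_sum, ← LinearMap.sum_apply, hK, Module.End.one_apply, inner_self_eq_norm_sq_to_K]
    simp
  exact_mod_cast h2

/-- By completeness `φ ↦ (K x φ)` is an isometry; the vector on the left is its adjoint applied to
`(u x • K x φ)`, and an adjoint of an isometry is a contraction. The proof pairs the vector with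
itself and uses Cauchy–Schwarz. -/
lemma norm_sum_smul_kraus_sq_le {K : X → E →ₗ[ℂ] E} (hK : ∑ x, (K x).adjoint * K x = 1)
    (u : X → ℂ) (φ : E) :
    ‖∑ x, u x • (K x).adjoint (K x φ)‖ ^ 2 ≤ ∑ x, ‖u x‖ ^ 2 * ‖K x φ‖ ^ 2 := by
  set a := ∑ x, u x • (K x).adjoint (K x φ) with ha
  have h1 : ‖a‖ ^ 2 ≤ ‖a‖ * √(∑ x, ‖u x‖ ^ 2 * ‖K x φ‖ ^ 2) := by
    have h2 : ((‖a‖ ^ 2 : ℝ) : ℂ) = ∑ x, ⟪K x a, u x • K x φ⟫_ℂ := by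
      have : ((‖a‖ ^ 2 : ℝ) : ℂ) = ⟪a, a⟫_ℂ := by rw [inner_self_eq_norm_sq_to_K]; simp
      rw [this]
      nth_rw 2 [ha]
      rw [inner_sum]
      refine Finset.sum_congr rfl fun x _ => ?_
      rw [inner_smul_right, inner_smul_right, LinearMap.adjoint_inner_right]
    have h3 := norm_sum_inner_le (fun x => K x a) (fun x => u x • K x φ)
    rw [← h2, sum_norm_kraus_sq hK, Real.sqrt_sq (norm_nonneg _), Complex.norm_real,
      Real.norm_of_nonneg (sq_nonneg _)] at h3
    simpa only [norm_smul, mul_pow] using h3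
  have hS : 0 ≤ ∑ x, ‖u x‖ ^ 2 * ‖K x φ‖ ^ 2 :=
    Finset.sum_nonneg fun x _ => by positivity
  rcases (norm_nonneg a).eq_or_lt with h0 | h0
  · rw [← h0]; simpa using hS
  · have : ‖a‖ ≤ √(∑ x, ‖u x‖ ^ 2 * ‖K x φ‖ ^ 2) := by
      refine le_of_mul_le_mul_left ?_ h0
      rwa [← sq]
    calc ‖a‖ ^ 2 ≤ √(∑ x, ‖u x‖ ^ 2 * ‖K x φ‖ ^ 2) ^ 2 := by gcongr
      _ = _ := Real.sq_sqrt hS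

/-- Completeness of one measurement gives the marginal of the other. Moving `K x` across gives `⟪K x
ψ, K x (L y)† (L y ψ)⟫`, to which the norm hypothesis applies; the `2 → 2` bound is the contraction
property on each side. -/
lemma isOverlap_of_ensemble {K : X → E →ₗ[ℂ] E} {L : Y → E →ₗ[ℂ] E}
    (hK : ∑ x, (K x).adjoint * K x = 1) (hL : ∑ y, (L y).adjoint * L y = 1)
    {ψ : ι → E} (hψ : ∑ i, ‖ψ i‖ ^ 2 = 1) {c : ℝ} (hc : 0 < c)
    (hKL : ∀ x y φ, ‖K x ((L y).adjoint φ)‖ ≤ √c * ‖φ‖) :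
    IsOverlap (fun x => ∑ i, ‖K x (ψ i)‖ ^ 2) (fun y => ∑ i, ‖L y (ψ i)‖ ^ 2)
      (fun x y => ∑ i, ⟪(K x).adjoint (K x (ψ i)), (L y).adjoint (L y (ψ i))⟫_ℂ) c where
  r_nonneg x := Finset.sum_nonneg fun i _ => sq_nonneg _
  q_nonneg y := Finset.sum_nonneg fun i _ => sq_nonneg _
  r_sum := by
    rw [Finset.sum_comm, ← hψ]
    exact Finset.sum_congr rfl fun i _ => sum_norm_kraus_sq hK _
  q_sum := by
    rw [Finset.sum_comm, ← hψ]
    exact Finset.sum_congr rfl fun i _ => sum_norm_kraus_sq hL _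
  c_pos := hc
  sum_right x := by
    rw [Finset.sum_comm, Complex.ofReal_sum]
    refine Finset.sum_congr rfl fun i _ => ?_
    have : ∑ y, (L y).adjoint (L y (ψ i)) = ψ i := by
      have := congrArg (fun A : E →ₗ[ℂ] E => A (ψ i)) hL
      simpa only [LinearMap.sum_apply, Module.End.mul_apply, Module.End.one_apply] using this
    rw [← inner_sum, this, LinearMap.adjoint_inner_left, inner_self_eq_norm_sq_to_K]
    simp
  sum_left y := by
    rw [Finset.sum_comm, Complex.ofReal_sum]
    refine Finset.sum_congr rfl fun i _ => ?_
    have : ∑ x, (K x).adjoint (K x (ψ i)) = ψ i := by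
      have := congrArg (fun A : E →ₗ[ℂ] E => A (ψ i)) hK
      simpa only [LinearMap.sum_apply, Module.End.mul_apply, Module.End.one_apply] using this
    rw [← sum_inner, this, LinearMap.adjoint_inner_right, inner_self_eq_norm_sq_to_K]
    simp
  norm_le x y := by
    simp only [LinearMap.adjoint_inner_left]
    refine (norm_sum_inner_le _ _).trans ?_
    have : √(∑ i, ‖K x ((L y).adjoint (L y (ψ i)))‖ ^ 2) ≤ √c * √(∑ i, ‖L y (ψ i)‖ ^ 2) := by
      rw [← Real.sqrt_mul hc.le, Finset.mul_sum]
      refine Real.sqrt_le_sqrt (Finset.sum_le_sum fun i _ => ?_)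
      calc _ ≤ (√c * ‖L y (ψ i)‖) ^ 2 := by gcongr; exact hKL _ _ _
        _ = _ := by rw [mul_pow, Real.sq_sqrt hc.le]
    calc _ ≤ √(∑ i, ‖K x (ψ i)‖ ^ 2) * (√c * √(∑ i, ‖L y (ψ i)‖ ^ 2)) := by gcongr
      _ = _ := by ring
  norm_sum_le u v := by
    have e : ∑ x, ∑ y, u x * v y *
          ∑ i, ⟪(K x).adjoint (K x (ψ i)), (L y).adjoint (L y (ψ i))⟫_ℂ
        = ∑ i, ⟪∑ x, star (u x) • (K x).adjoint (K x (ψ i)),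
            ∑ y, v y • (L y).adjoint (L y (ψ i))⟫_ℂ := by
      calc _ = ∑ i, ∑ x, ∑ y, u x * v y *
              ⟪(K x).adjoint (K x (ψ i)), (L y).adjoint (L y (ψ i))⟫_ℂ := by
            conv_rhs => rw [Finset.sum_comm]
            refine Finset.sum_congr rfl fun x _ => ?_
            rw [Finset.sum_comm]
            simp only [Finset.mul_sum]
        _ = _ := by
            refine Finset.sum_congr rfl fun i _ => ?_
            rw [sum_inner]
            refine Finset.sum_congr rfl fun x _ => ?_
            rw [inner_sum]
            refine Finset.sum_congr rfl fun y _ => ?_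
            rw [inner_smul_left, inner_smul_right]
            simp
            ring
    rw [e]
    refine (norm_sum_inner_le _ _).trans ?_
    gcongr
    · simp only [Finset.mul_sum]
      rw [Finset.sum_comm]
      refine Finset.sum_le_sum fun i _ => ?_
      simpa using norm_sum_smul_kraus_sq_le hK (fun x => star (u x)) (ψ i)
    · simp only [Finset.mul_sum]
      rw [Finset.sum_comm]
      exact Finset.sum_le_sum fun i _ => norm_sum_smul_kraus_sq_le hL v (ψ i)

/-- Entropic uncertainty relations for two measurements with Kraus operators `K` and `L`. -/
theorem entropic_uncertainty [DecidableEq X] [DecidableEq Y] {K : X → E →ₗ[ℂ] E}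
    {L : Y → E →ₗ[ℂ] E} (hK : ∑ x, (K x).adjoint * K x = 1) (hL : ∑ y, (L y).adjoint * L y = 1)
    {ρ : E →ₗ[ℂ] E} (hρ : IsState ρ) {c : ℝ} (hc : 0 < c)
    (hKL : ∀ x y φ, ‖K x ((L y).adjoint φ)‖ ≤ √c * ‖φ‖) :
    -Real.logb 2 c ≤ vonNeumannEntropy (registerState K ρ) + vonNeumannEntropy (registerState L ρ) ∧
    ∀ α β : ℝ≥0∞, α⁻¹ + β⁻¹ = 2 →
      -Real.logb 2 c ≤ renyiEntropy α (registerState K ρ) + renyiEntropy β (registerState L ρ) := by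
  obtain ⟨ψ, hψ⟩ := hρ.exists_ensemble
  have h1 : ∑ i, ‖ψ i‖ ^ 2 = 1 := by
    have h := hψ 1
    rw [one_mul, hρ.2] at h
    simp only [Module.End.one_apply, inner_self_eq_norm_sq_to_K] at h
    have h' : ((∑ i, ‖ψ i‖ ^ 2 : ℝ) : ℂ) = 1 := by rw [h]; simp
    exact_mod_cast h'
  have h := isOverlap_of_ensemble hK hL h1 hc hKL
  rw [registerState_eq_diagonal hψ, registerState_eq_diagonal hψ]
  exact ⟨h.vonNeumannEntropy_add_le, fun α β hαβ => h.renyiEntropy_add_le hαβ⟩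

end EntropicUncertainty

end

/-! ### Spectral projections, completeness and Heisenberg evolution -/

section

variable {E : Type*} [NormedAddCommGroup E] [InnerProductSpace ℂ E]

lemma weakKraus_mul_comm (P : E →ₗ[ℂ] E) (p : ℝ) (g h : ℂ) :
    weakKraus P p g * weakKraus P p h = weakKraus P p h * weakKraus P p g := by
  have : Commute (weakKraus P p g) (weakKraus P p h) := by
    unfold weakKraus
    apply Commute.add_left
    · exact (Commute.one_left _).smul_left _
    · apply Commute.add_right
      · exact (Commute.one_right _).smul_right _
      · exact ((Commute.refl P).smul_left _).smul_right _
  exact this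

variable [FiniteDimensional ℂ E]

section Projections

open scoped InnerProductSpace

lemma eigenProj_adjoint (A : E →ₗ[ℂ] E) (a : ℂ) : (eigenProj A a).adjoint = eigenProj A a :=
  (LinearMap.isSymmetric_iff_isSelfAdjoint _).1
    (Submodule.starProjection_isSymmetric (Module.End.eigenspace A a))

lemma eigenProj_mul_self (A : E →ₗ[ℂ] E) (a : ℂ) : eigenProj A a * eigenProj A a = eigenProj A a := by
  ext φ
  exact Submodule.starProjection_eq_self_iff.2 (Submodule.starProjection_apply_mem _ φ)

lemma norm_eigenProj_apply_le (A : E →ₗ[ℂ] E) (a : ℂ) (φ : E) : ‖eigenProj A a φ‖ ≤ ‖φ‖ :=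
  Submodule.norm_starProjection_apply_le _ φ

lemma eigenProj_mul_eq_zero {A : E →ₗ[ℂ] E} (hA : A.IsSymmetric) {a b : ℂ} (hab : a ≠ b) :
    eigenProj A a * eigenProj A b = 0 := by
  ext φ
  refine (Submodule.starProjection_apply_eq_zero_iff _).2 ?_
  rw [Submodule.mem_orthogonal]
  intro χ hχ
  exact hA.orthogonalFamily_eigenspaces hab ⟨χ, hχ⟩ ⟨_, Submodule.starProjection_apply_mem _ φ⟩

lemma sum_eigenProj {A : E →ₗ[ℂ] E} (hA : A.IsSymmetric) :
    ∑ w : Module.End.Eigenvalues A, eigenProj A w = 1 := by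
  classical
  ext φ
  have hmem : φ ∈ ⨆ w : Module.End.Eigenvalues A, Module.End.eigenspace A w := by
    rw [(hA.direct_sum_isInternal).submodule_iSup_eq_top]
    trivial
  have := hA.orthogonalFamily_eigenspaces'.sum_projection_of_mem_iSup φ hmem
  rw [LinearMap.sum_apply]
  exact this

lemma adjoint_mul (A B : E →ₗ[ℂ] E) : (A * B).adjoint = B.adjoint * A.adjoint :=
  LinearMap.adjoint_comp A B

lemma tr_adjoint (A : E →ₗ[ℂ] E) : tr A.adjoint = star (tr A) := by
  rw [tr, tr, LinearMap.trace_eq_sum_inner _ (stdOrthonormalBasis ℂ E),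
    LinearMap.trace_eq_sum_inner _ (stdOrthonormalBasis ℂ E), star_sum]
  refine Finset.sum_congr rfl fun i _ => ?_
  rw [LinearMap.adjoint_inner_right]
  exact (inner_conj_symm _ _).symm

lemma tr_eigenProj_mul (A : E →ₗ[ℂ] E) (a : ℂ) (B : E →ₗ[ℂ] E) :
    tr (eigenProj A a * B) = ∑ i,
      ⟪((stdOrthonormalBasis ℂ (Module.End.eigenspace A a) i : Module.End.eigenspace A a) : E),
        B (stdOrthonormalBasis ℂ (Module.End.eigenspace A a) i : Module.End.eigenspace A a)⟫_ℂ := by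
  have h1 : eigenProj A a = ∑ i, ((InnerProductSpace.rankOne ℂ
      ((stdOrthonormalBasis ℂ (Module.End.eigenspace A a) i : Module.End.eigenspace A a) : E)
      ((stdOrthonormalBasis ℂ (Module.End.eigenspace A a) i : Module.End.eigenspace A a) : E)
        : E →L[ℂ] E) : E →ₗ[ℂ] E) := by
    rw [eigenProj, (stdOrthonormalBasis ℂ (Module.End.eigenspace A a)).starProjection_eq_sum_rankOne]
    ext φ
    simp [LinearMap.sum_apply]
  rw [tr_mul_comm, h1, Finset.mul_sum, tr, map_sum]
  refine Finset.sum_congr rfl fun i _ => ?_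
  rw [← InnerProductSpace.trace_rankOne]
  congr 1
  ext φ
  simp

lemma multiplicity_eq (A : E →ₗ[ℂ] E) (a : ℂ) :
    multiplicity A a = Module.finrank ℂ (Module.End.eigenspace A a) := by
  have h := tr_eigenProj_mul A a 1
  rw [mul_one] at h
  rw [multiplicity, h]
  have : ∀ i, ⟪((stdOrthonormalBasis ℂ (Module.End.eigenspace A a) i : Module.End.eigenspace A a) : E),
        (1 : E →ₗ[ℂ] E) (stdOrthonormalBasis ℂ (Module.End.eigenspace A a) i :
          Module.End.eigenspace A a)⟫_ℂ = 1 := by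
    intro i
    rw [Module.End.one_apply, inner_self_eq_norm_sq_to_K, Submodule.norm_coe,
      (stdOrthonormalBasis ℂ (Module.End.eigenspace A a)).norm_eq_one]
    simp
  rw [Finset.sum_congr rfl fun i _ => this i]
  simp

/-- The trace is a sum of diagonal entries of `B` over an orthonormal basis of the eigenspace, each
at most `C`. This keeps the error constants independent of the dimension. -/
lemma norm_tr_eigenProj_mul_le (A : E →ₗ[ℂ] E) (a : ℂ) {B : E →ₗ[ℂ] E} {C : ℝ}
    (hB : ∀ φ, ‖B φ‖ ≤ C * ‖φ‖) : ‖tr (eigenProj A a * B)‖ ≤ C * multiplicity A a := by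
  rw [tr_eigenProj_mul, multiplicity_eq]
  refine (norm_sum_le _ _).trans ?_
  have : ∀ i, ‖⟪((stdOrthonormalBasis ℂ (Module.End.eigenspace A a) i : Module.End.eigenspace A a) : E),
        B (stdOrthonormalBasis ℂ (Module.End.eigenspace A a) i :
          Module.End.eigenspace A a)⟫_ℂ‖ ≤ C := by
    intro i
    have h1 : ‖((stdOrthonormalBasis ℂ (Module.End.eigenspace A a) i : Module.End.eigenspace A a) : E)‖
      = 1 := by
      rw [Submodule.norm_coe, (stdOrthonormalBasis ℂ (Module.End.eigenspace A a)).norm_eq_one]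
    refine (norm_inner_le_norm _ _).trans ?_
    rw [h1, one_mul]
    refine (hB _).trans_eq ?_
    rw [h1, mul_one]
  refine (Finset.sum_le_sum fun i _ => this i).trans_eq ?_
  simp [mul_comm]

lemma one_le_multiplicity {A : E →ₗ[ℂ] E} (w : Module.End.Eigenvalues A) : 1 ≤ multiplicity A w := by
  rw [multiplicity_eq]
  have : 0 < Module.finrank ℂ (Module.End.eigenspace A w) := by
    rw [Module.finrank_pos_iff, Submodule.nontrivial_iff_ne_bot]
    exact w.2
  exact_mod_cast this

lemma exists_eigenvector_of_multiplicity_eq_one {A : E →ₗ[ℂ] E} {a : ℂ}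
    (h : multiplicity A a = 1) :
    ∃ e : E, ‖e‖ = 1 ∧ (∀ φ, eigenProj A a φ = ⟪e, φ⟫_ℂ • e) ∧
      ∀ B, tr (eigenProj A a * B) = ⟪e, B e⟫_ℂ := by
  rw [multiplicity_eq] at h
  have h1 : Module.finrank ℂ (Module.End.eigenspace A a) = 1 := by exact_mod_cast h
  have hu : Fintype.card (Fin (Module.finrank ℂ (Module.End.eigenspace A a))) = 1 := by simp [h1]
  obtain ⟨i, hi⟩ := Fintype.card_eq_one_iff.1 hu
  have : Unique (Fin (Module.finrank ℂ (Module.End.eigenspace A a))) := ⟨⟨i⟩, hi⟩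
  refine ⟨(stdOrthonormalBasis ℂ (Module.End.eigenspace A a) default : Module.End.eigenspace A a),
    ?_, fun φ => ?_, fun B => ?_⟩
  · rw [Submodule.norm_coe, (stdOrthonormalBasis ℂ (Module.End.eigenspace A a)).norm_eq_one]
  · rw [eigenProj, (stdOrthonormalBasis ℂ (Module.End.eigenspace A a)).starProjection_eq_sum_rankOne]
    simp
  · rw [tr_eigenProj_mul, Fintype.sum_unique]

end Projections

section WeakKraus

lemma weakKraus_adjoint_apply (A : E →ₗ[ℂ] E) (a : ℂ) (p : ℝ) (g : ℂ) :
    (weakKraus (eigenProj A a) p g).adjoint = weakKraus (eigenProj A a) p (star g) := by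
  have h1 : (1 : E →ₗ[ℂ] E).adjoint = 1 := LinearMap.adjoint_id
  rw [weakKraus, weakKraus, map_add, LinearEquiv.map_smulₛₗ, LinearEquiv.map_smulₛₗ, eigenProj_adjoint, h1,
    Complex.conj_ofReal]
  rfl

variable {V Wt : E →ₗ[ℂ] E} {v : ℂ} {J : Type*} [Fintype J]

lemma sum_forwardKraus (hW : Wt.IsSymmetric) (M : WeakMeasurement J (eigenProj V v)) :
    ∑ x, (forwardKraus Wt M x).adjoint * forwardKraus Wt M x = 1 := by
  have h : ∀ x : J × Module.End.Eigenvalues Wt,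
      (forwardKraus Wt M x).adjoint * forwardKraus Wt M x
        = (M.kraus x.1).adjoint * eigenProj Wt x.2 * M.kraus x.1 := by
    intro x
    rw [forwardKraus, adjoint_mul, eigenProj_adjoint, mul_assoc, ← mul_assoc (eigenProj _ _),
      eigenProj_mul_self, mul_assoc]
  simp only [h]
  rw [Fintype.sum_prod_type]
  simp only [← Finset.sum_mul, ← Finset.mul_sum, sum_eigenProj hW, mul_one]
  exact M.complete

/-- The weak Kraus operators are normal, being combinations of `1` and a projector, so `∑ K K† = ∑
K† K = 1`. -/
lemma sum_reverseKraus (hW : Wt.IsSymmetric) (M : WeakMeasurement J (eigenProj V v)) :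
    ∑ x, (reverseKraus Wt M x).adjoint * reverseKraus Wt M x = 1 := by
  have h : ∀ x : Module.End.Eigenvalues Wt × J,
      (reverseKraus Wt M x).adjoint * reverseKraus Wt M x
        = eigenProj Wt x.1 * ((M.kraus x.2).adjoint * M.kraus x.2) * eigenProj Wt x.1 := by
    intro x
    have : M.kraus x.2 * (M.kraus x.2).adjoint = (M.kraus x.2).adjoint * M.kraus x.2 := by
      rw [WeakMeasurement.kraus, weakKraus_adjoint_apply, weakKraus_mul_comm]
    rw [reverseKraus, LinearMap.adjoint_adjoint, adjoint_mul, eigenProj_adjoint, ← this]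
    simp only [mul_assoc]
  simp only [h]
  rw [Fintype.sum_prod_type]
  simp only [← Finset.sum_mul, ← Finset.mul_sum]
  have hc : ∑ j, (M.kraus j).adjoint * M.kraus j = 1 := M.complete
  simp only [hc, mul_one, eigenProj_mul_self]
  exact sum_eigenProj hW

end WeakKraus

section Heisenberg

lemma evolution_unitary {H : E →ₗ[ℂ] E} (hH : H.IsSymmetric) (t : ℝ) :
    (evolution H t).adjoint * evolution H t = 1 ∧ evolution H t * (evolution H t).adjoint = 1 := by
  have hsa : IsSelfAdjoint (LinearMap.toContinuousLinearMap H) := by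
    rw [ContinuousLinearMap.isSelfAdjoint_iff_isSymmetric]
    exact hH
  have hskew : ((-Complex.I * (t : ℂ)) • LinearMap.toContinuousLinearMap H) ∈
      skewAdjoint (E →L[ℂ] E) := by
    rw [skewAdjoint.mem_iff, star_smul, hsa.star_eq]
    simp
  have := FiniteDimensional.complete ℂ E
  let : NormedAlgebra ℚ (E →L[ℂ] E) := .restrictScalars ℚ ℂ _
  have hU := NormedSpace.exp_mem_unitary_of_mem_skewAdjoint hskew
  rw [Unitary.mem_iff] at hU
  have hadj : (evolution H t).adjoint = ((star (NormedSpace.exp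
      ((-Complex.I * (t : ℂ)) • LinearMap.toContinuousLinearMap H)) : E →L[ℂ] E) : E →ₗ[ℂ] E) := by
    rw [eq_comm, LinearMap.eq_adjoint_iff]
    intro x y
    exact ContinuousLinearMap.adjoint_inner_left _ _ _
  rw [hadj]
  refine ⟨?_, ?_⟩
  · ext φ; exact congrArg (fun A : E →L[ℂ] E => A φ) hU.1
  · ext φ; exact congrArg (fun A : E →L[ℂ] E => A φ) hU.2

lemma heisenberg_isSymmetric (H : E →ₗ[ℂ] E) {W : E →ₗ[ℂ] E} (hW : W.IsSymmetric) (t : ℝ) :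
    (heisenberg H W t).IsSymmetric := by
  intro x y
  simp only [heisenberg, Module.End.mul_apply]
  rw [LinearMap.adjoint_inner_left, LinearMap.adjoint_inner_right, hW]

lemma isDegenerate_heisenberg {H W : E →ₗ[ℂ] E} (hH : H.IsSymmetric) (t : ℝ)
    (hW : IsDegenerate W) : IsDegenerate (heisenberg H W t) := by
  obtain ⟨w, hw⟩ := hW
  obtain ⟨h1, h2⟩ := evolution_unitary hH t
  refine ⟨w, hw.trans ?_⟩
  have hinj : Function.Injective (evolution H t).adjoint := by
    intro x y hxy
    have := congrArg (evolution H t) hxy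
    simpa only [← Module.End.mul_apply, h2, Module.End.one_apply] using this
  -- `U†` carries eigenvectors of `W` to eigenvectors of `U† W U` with the same eigenvalue.
  have hle : (Module.End.eigenspace W w).map (evolution H t).adjoint
      ≤ Module.End.eigenspace (heisenberg H W t) w := by
    rintro _ ⟨x, hx, rfl⟩
    have hx' : W x = w • x := Module.End.mem_eigenspace_iff.1 hx
    rw [Module.End.mem_eigenspace_iff, heisenberg, ← Module.End.mul_apply, mul_assoc, h2, mul_one,
      Module.End.mul_apply, hx', map_smul]
  rw [(Submodule.equivMapOfInjective _ hinj (Module.End.eigenspace W w)).finrank_eq]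
  exact Submodule.finrank_mono hle

end Heisenberg

end

section

/-! ### Operator norm bounds -/

section OperatorBounds

variable {E : Type*} [NormedAddCommGroup E] [InnerProductSpace ℂ E]

/-- `A` has operator norm at most `C`. -/
def NormBound (A : E →ₗ[ℂ] E) (C : ℝ) : Prop := ∀ φ, ‖A φ‖ ≤ C * ‖φ‖

lemma NormBound.one : NormBound (1 : E →ₗ[ℂ] E) 1 := fun φ => by simp

lemma NormBound.mul {A B : E →ₗ[ℂ] E} {C D : ℝ} (hA : NormBound A C) (hB : NormBound B D)
    (hC : 0 ≤ C) : NormBound (A * B) (C * D) := fun φ =>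
  calc ‖A (B φ)‖ ≤ C * ‖B φ‖ := hA _
    _ ≤ C * (D * ‖φ‖) := by gcongr; exact hB φ
    _ = _ := by ring

lemma NormBound.add {A B : E →ₗ[ℂ] E} {C D : ℝ} (hA : NormBound A C) (hB : NormBound B D) :
    NormBound (A + B) (C + D) := fun φ =>
  (norm_add_le _ _).trans ((add_le_add (hA φ) (hB φ)).trans_eq (by ring))

lemma NormBound.smul {A : E →ₗ[ℂ] E} {C D : ℝ} (hA : NormBound A C) {z : ℂ} (hz : ‖z‖ ≤ D) :
    NormBound (z • A) (D * C) := fun φ => by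
  rw [LinearMap.smul_apply, norm_smul, mul_assoc]
  exact mul_le_mul hz (hA φ) (norm_nonneg _) ((norm_nonneg z).trans hz)

lemma NormBound.mono {A : E →ₗ[ℂ] E} {C D : ℝ} (hA : NormBound A C) (h : C ≤ D) :
    NormBound A D := fun φ => (hA φ).trans (by gcongr)

lemma weakKraus_eq_smul (P : E →ₗ[ℂ] E) (p : ℝ) (a : ℂ) :
    weakKraus P p ((√p : ℝ) * a) = ((√p : ℝ) : ℂ) • (1 + a • P) := by
  rw [weakKraus, smul_add, smul_smul]

lemma tr_add (A B : E →ₗ[ℂ] E) : tr (A + B) = tr A + tr B := map_add _ _ _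

lemma tr_smul (z : ℂ) (A : E →ₗ[ℂ] E) : tr (z • A) = z * tr A := by
  rw [tr, map_smul, smul_eq_mul, tr]

variable [FiniteDimensional ℂ E]

lemma NormBound.eigenProj (A : E →ₗ[ℂ] E) (a : ℂ) : NormBound (eigenProj A a) 1 := fun φ => by
  rw [one_mul]; exact norm_eigenProj_apply_le A a φ

lemma NormBound.norm_tr_le {B : E →ₗ[ℂ] E} {C : ℝ} (hB : NormBound B C) (A : E →ₗ[ℂ] E) (a : ℂ) :
    ‖tr (OTOC.eigenProj A a * B)‖ ≤ C * multiplicity A a :=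
  norm_tr_eigenProj_mul_le A a hB

end OperatorBounds

/-! ### Second-order expansion of the overlap trace -/

section Expansion

variable {E : Type*} [NormedAddCommGroup E] [InnerProductSpace ℂ E] [FiniteDimensional ℂ E]
  (V Wt : E →ₗ[ℂ] E)

/-- First-order part of the expansion of the logarithm of the overlap. -/
def linearTerm (v₁ v₂ a₁ a₂ w : ℂ) : ℝ :=
  2 * (a₁.re * condProb V Wt v₁ w + a₂.re * condProb V Wt v₂ w)

open scoped Classical in
/-- Second-order part of the expansion of the overlap. -/
def quadraticTerm (v₁ v₂ a₁ a₂ w : ℂ) : ℝ :=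
  (2 * (a₁ * a₂ * quasiprob V Wt 1 v₁ w v₂ w).re + ‖a₁‖ ^ 2 * (quasiprob V Wt 1 v₁ w v₁ w).re
    + ‖a₂‖ ^ 2 * (quasiprob V Wt 1 v₂ w v₂ w).re) / multiplicity Wt w
    + 2 * condProb V Wt v₁ w * (a₁ * star a₂).re * (if v₁ = v₂ then 1 else 0)

/-- In the relative couplings `a = g / √p` the detector probabilities drop out, and what remains is
minus the second-order Taylor polynomial `l + q - l² / 2` of `log (1 + l + q)`. -/
lemma log_two_mul_couplingTerms (v₁ v₂ a₁ a₂ w : ℂ) {p₁ p₂ : ℝ} (h₁ : 0 < p₁) (h₂ : 0 < p₂)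
    (hm : multiplicity Wt w ≠ 0) :
    Real.log 2 * couplingTerms V Wt v₁ v₂ p₁ p₂ ((√p₁ : ℝ) * a₁) ((√p₂ : ℝ) * a₂) w w
      = -(linearTerm V Wt v₁ v₂ a₁ a₂ w + quadraticTerm V Wt v₁ v₂ a₁ a₂ w)
        + linearTerm V Wt v₁ v₂ a₁ a₂ w ^ 2 / 2 := by
  have h2 : Real.log 2 ≠ 0 := (Real.log_pos one_lt_two).ne'
  obtain ⟨s₁, hs₁, rfl⟩ : ∃ s : ℝ, 0 < s ∧ p₁ = s ^ 2 :=
    ⟨√p₁, Real.sqrt_pos.2 h₁, (Real.sq_sqrt h₁.le).symm⟩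
  obtain ⟨s₂, hs₂, rfl⟩ : ∃ s : ℝ, 0 < s ∧ p₂ = s ^ 2 :=
    ⟨√p₂, Real.sqrt_pos.2 h₂, (Real.sq_sqrt h₂.le).symm⟩
  rw [couplingTerms, classicalSecondOrder, linearTerm, quadraticTerm, C₁, C₁, C₂, C₂', C₂',
    ← mul_pow, Real.sqrt_sq hs₁.le, Real.sqrt_sq hs₂.le, Real.sqrt_sq (by positivity)]
  have e1 : ((s₁ : ℂ) * a₁ * (s₂ * a₂) * quasiprob V Wt 1 v₁ w v₂ w).re
      = s₁ * s₂ * (a₁ * a₂ * quasiprob V Wt 1 v₁ w v₂ w).re := by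
    rw [show (s₁ : ℂ) * a₁ * (s₂ * a₂) * quasiprob V Wt 1 v₁ w v₂ w
      = ((s₁ * s₂ : ℝ) : ℂ) * (a₁ * a₂ * quasiprob V Wt 1 v₁ w v₂ w) by push_cast; ring,
      Complex.re_ofReal_mul]
  have e2 : ((s₁ : ℂ) * a₁ * star ((s₂ : ℂ) * a₂)).re = s₁ * s₂ * (a₁ * star a₂).re := by
    rw [show (s₁ : ℂ) * a₁ * star ((s₂ : ℂ) * a₂) = ((s₁ * s₂ : ℝ) : ℂ) * (a₁ * star a₂) by
      simp; ring, Complex.re_ofReal_mul]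
  rw [e1, e2, Complex.re_ofReal_mul, Complex.re_ofReal_mul, norm_mul, norm_mul,
    Complex.norm_of_nonneg hs₁.le, Complex.norm_of_nonneg hs₂.le]
  generalize (a₁ * a₂ * quasiprob V Wt 1 v₁ w v₂ w).re = A₁₂
  generalize (quasiprob V Wt 1 v₁ w v₁ w).re = A₁₁
  generalize (quasiprob V Wt 1 v₂ w v₂ w).re = A₂₂
  generalize (a₁ * star a₂).re = B
  generalize (if v₁ = v₂ then (1 : ℝ) else 0) = d
  field_simp
  ring

variable {V Wt}

lemma abs_condProb_le (v : ℂ) {w : ℂ} (hm : 1 ≤ multiplicity Wt w) : |condProb V Wt v w| ≤ 1 := by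
  have hm0 : 0 < multiplicity Wt w := by linarith
  rw [condProb, abs_div, abs_of_pos hm0, div_le_one hm0, tr_mul_comm]
  refine (Complex.abs_re_le_norm _).trans (((NormBound.eigenProj V v).norm_tr_le Wt w).trans ?_)
  rw [one_mul]

lemma norm_quasiprob_le (v v' w : ℂ) : ‖quasiprob V Wt 1 v w v' w‖ ≤ multiplicity Wt w := by
  rw [quasiprob, mul_one, mul_assoc, mul_assoc]
  have := (((NormBound.eigenProj V v').mul ((NormBound.eigenProj Wt w).mul
    (NormBound.eigenProj V v) zero_le_one) zero_le_one).norm_tr_le Wt w)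
  simpa using this

lemma abs_linearTerm_le (v₁ v₂ : ℂ) {a₁ a₂ w : ℂ} {ε : ℝ} (hm : 1 ≤ multiplicity Wt w)
    (h₁ : ‖a₁‖ ≤ ε) (h₂ : ‖a₂‖ ≤ ε) : |linearTerm V Wt v₁ v₂ a₁ a₂ w| ≤ 4 * ε := by
  have e1 : |a₁.re * condProb V Wt v₁ w| ≤ ε * 1 := by
    rw [abs_mul]
    exact mul_le_mul ((Complex.abs_re_le_norm _).trans h₁) (abs_condProb_le v₁ hm) (abs_nonneg _)
      ((norm_nonneg _).trans h₁)
  have e2 : |a₂.re * condProb V Wt v₂ w| ≤ ε * 1 := by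
    rw [abs_mul]
    exact mul_le_mul ((Complex.abs_re_le_norm _).trans h₂) (abs_condProb_le v₂ hm) (abs_nonneg _)
      ((norm_nonneg _).trans h₂)
  rw [linearTerm, abs_mul, abs_two]
  have := abs_add_le (a₁.re * condProb V Wt v₁ w) (a₂.re * condProb V Wt v₂ w)
  linarith

lemma abs_quadraticTerm_le (v₁ v₂ : ℂ) {a₁ a₂ w : ℂ} {ε : ℝ} (hm : 1 ≤ multiplicity Wt w)
    (h₁ : ‖a₁‖ ≤ ε) (h₂ : ‖a₂‖ ≤ ε) : |quadraticTerm V Wt v₁ v₂ a₁ a₂ w| ≤ 6 * ε ^ 2 := by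
  have hm0 : 0 < multiplicity Wt w := by linarith
  have hε : 0 ≤ ε := (norm_nonneg _).trans h₁
  have hq : ∀ v v', |(quasiprob V Wt 1 v w v' w).re| ≤ multiplicity Wt w := fun v v' =>
    (Complex.abs_re_le_norm _).trans (norm_quasiprob_le _ _ _)
  have e1 : |(a₁ * a₂ * quasiprob V Wt 1 v₁ w v₂ w).re| ≤ ε ^ 2 * multiplicity Wt w := by
    refine (Complex.abs_re_le_norm _).trans ?_
    rw [norm_mul, norm_mul, sq]
    gcongr
    exact norm_quasiprob_le _ _ _
  have e2 : |‖a₁‖ ^ 2 * (quasiprob V Wt 1 v₁ w v₁ w).re| ≤ ε ^ 2 * multiplicity Wt w := by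
    rw [abs_mul, abs_of_nonneg (sq_nonneg ‖a₁‖)]
    gcongr
    exact hq _ _
  have e3 : |‖a₂‖ ^ 2 * (quasiprob V Wt 1 v₂ w v₂ w).re| ≤ ε ^ 2 * multiplicity Wt w := by
    rw [abs_mul, abs_of_nonneg (sq_nonneg ‖a₂‖)]
    gcongr
    exact hq _ _
  have e4 : |condProb V Wt v₁ w * (a₁ * star a₂).re| ≤ 1 * (ε * ε) := by
    rw [abs_mul]
    refine mul_le_mul (abs_condProb_le _ hm) ((Complex.abs_re_le_norm _).trans ?_) (abs_nonneg _)
      zero_le_one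
    rw [norm_mul, norm_star]
    gcongr
  have e5 : |2 * condProb V Wt v₁ w * (a₁ * star a₂).re * (if v₁ = v₂ then 1 else 0)|
      ≤ 2 * ε ^ 2 := by
    split_ifs
    · rw [mul_one, mul_assoc, abs_mul, abs_two]; linarith
    · rw [mul_zero, abs_zero]; positivity
  have e6 : |(2 * (a₁ * a₂ * quasiprob V Wt 1 v₁ w v₂ w).re
      + ‖a₁‖ ^ 2 * (quasiprob V Wt 1 v₁ w v₁ w).re
      + ‖a₂‖ ^ 2 * (quasiprob V Wt 1 v₂ w v₂ w).re) / multiplicity Wt w| ≤ 4 * ε ^ 2 := by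
    rw [abs_div, abs_of_pos hm0, div_le_iff₀ hm0]
    rw [abs_le] at *
    constructor <;> linarith
  rw [quadraticTerm]
  refine (abs_add_le _ _).trans ?_
  linarith

lemma star_tr_eigenProj_mul (v w : ℂ) :
    star (tr (eigenProj Wt w * eigenProj V v)) = tr (eigenProj Wt w * eigenProj V v) := by
  rw [← tr_adjoint, adjoint_mul, eigenProj_adjoint, eigenProj_adjoint, tr_mul_comm]

lemma tr_eigenProj_mul_eigenProj (v : ℂ) {w : ℂ} (hm : multiplicity Wt w ≠ 0) :
    tr (eigenProj Wt w * eigenProj V v) = ((multiplicity Wt w * condProb V Wt v w : ℝ) : ℂ) := by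
  rw [condProb, mul_div_cancel₀ _ hm, tr_mul_comm (eigenProj V v)]
  exact (Complex.conj_eq_iff_re.1 (star_tr_eigenProj_mul v w)).symm

/-- For equal `w` arguments, reversing the product of projectors is undone by cyclicity of the
trace, so the quasiprobability is real. -/
lemma star_quasiprob (v v' w : ℂ) :
    star (quasiprob V Wt 1 v w v' w) = quasiprob V Wt 1 v w v' w := by
  rw [quasiprob, mul_one, ← tr_adjoint]
  simp only [adjoint_mul, eigenProj_adjoint]
  rw [tr_mul_comm, mul_assoc (eigenProj Wt w * eigenProj V v')]
  simp only [mul_assoc]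

lemma quasiprob_comm (v v' w : ℂ) : quasiprob V Wt 1 v w v' w = quasiprob V Wt 1 v' w v w := by
  rw [quasiprob, quasiprob, mul_one, mul_one, mul_assoc, tr_mul_comm, mul_assoc _ _ (eigenProj V v'),
    ← mul_assoc]

lemma exists_tr_overlap_eq (hV : V.IsSymmetric) (v₁ v₂ : ℂ) {a₁ a₂ w : ℂ} {ε : ℝ}
    (hm : 1 ≤ multiplicity Wt w) (h₁ : ‖a₁‖ ≤ ε) (h₂ : ‖a₂‖ ≤ ε) (hε : ε ≤ 1) :
    ∃ x : ℝ, |x| ≤ 5 * ε ^ 3 ∧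
      (tr (eigenProj Wt w * ((1 + a₂ • eigenProj V v₂) * (1 + star a₁ • eigenProj V v₁) *
        eigenProj Wt w * (1 + a₁ • eigenProj V v₁) * (1 + star a₂ • eigenProj V v₂)))).re
      = multiplicity Wt w * (1 + linearTerm V Wt v₁ v₂ a₁ a₂ w
        + quadraticTerm V Wt v₁ v₂ a₁ a₂ w + x) := by
  have hm0 : 0 < multiplicity Wt w := by linarith
  have hε0 : 0 ≤ ε := (norm_nonneg _).trans h₁
  set T := eigenProj Wt w with hT
  set P := eigenProj V v₁ with hP
  set Q := eigenProj V v₂ with hQ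
  set m := multiplicity Wt w with hmdef
  have hTT : T * T = T := eigenProj_mul_self _ _
  let Z := a₁ • P + star a₂ • Q
  let Z' := star a₁ • P + a₂ • Q
  let Y := (a₁ * star a₂) • (P * Q)
  let Y' := (a₂ * star a₁) • (Q * P)
  have hP1 : NormBound P 1 := NormBound.eigenProj _ _
  have hQ1 : NormBound Q 1 := NormBound.eigenProj _ _
  have hT1 : NormBound T 1 := NormBound.eigenProj _ _
  have h₁' : ‖star a₁‖ ≤ ε := by rwa [norm_star]
  have h₂' : ‖star a₂‖ ≤ ε := by rwa [norm_star]
  have hZ : NormBound Z (2 * ε) :=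
    ((hP1.smul h₁).add (hQ1.smul h₂')).mono (by linarith)
  have hZ' : NormBound Z' (2 * ε) :=
    ((hP1.smul h₁').add (hQ1.smul h₂)).mono (by linarith)
  have hY : NormBound Y (ε ^ 2) := by
    refine ((hP1.mul hQ1 zero_le_one).smul (D := ε ^ 2) ?_).mono (by simp)
    rw [norm_mul, sq]; gcongr
  have hY' : NormBound Y' (ε ^ 2) := by
    refine ((hQ1.mul hP1 zero_le_one).smul (D := ε ^ 2) ?_).mono (by simp)
    rw [norm_mul, sq]; gcongr
  -- `Z`, `Z'` collect the first-order and `Y`, `Y'` the second-order parts of the two products of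
  -- factors. `B` holds everything of order three and four: `2ε³ + 2ε³ + ε⁴ ≤ 5ε³`.
  let B := Z' * (T * Y) + Y' * (T * Z) + Y' * (T * Y)
  have hB : NormBound B (5 * ε ^ 3) := by
    refine (((hZ'.mul (hT1.mul hY zero_le_one) (by positivity)).add
      (hY'.mul (hT1.mul hZ zero_le_one) (by positivity))).add
      (hY'.mul (hT1.mul hY zero_le_one) (by positivity))).mono ?_
    have : ε ^ 3 * ε ≤ ε ^ 3 * 1 := by gcongr
    nlinarith
  refine ⟨(tr (T * B)).re / m, ?_, ?_⟩
  · rw [abs_div, abs_of_pos hm0, div_le_iff₀ hm0]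
    exact (Complex.abs_re_le_norm _).trans (hB.norm_tr_le Wt w)
  have hTQTP : tr (T * (Q * (T * P))) = quasiprob V Wt 1 v₁ w v₂ w := by
    rw [quasiprob, mul_one]; simp only [mul_assoc]; rfl
  have hTPTQ : tr (T * (P * (T * Q))) = quasiprob V Wt 1 v₁ w v₂ w := by
    rw [quasiprob_comm, quasiprob, mul_one]; simp only [mul_assoc]; rfl
  have hTPTP : tr (T * (P * (T * P))) = quasiprob V Wt 1 v₁ w v₁ w := by
    rw [quasiprob, mul_one]; simp only [mul_assoc]; rfl
  have hTQTQ : tr (T * (Q * (T * Q))) = quasiprob V Wt 1 v₂ w v₂ w := by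
    rw [quasiprob, mul_one]; simp only [mul_assoc]; rfl
  have hcyc : ∀ A : E →ₗ[ℂ] E, tr (T * (A * T)) = tr (T * A) := by
    intro A
    rw [tr_mul_comm, mul_assoc, hTT, tr_mul_comm]
  have hPQ : tr (T * (P * Q)) = tr (T * P) * (if v₁ = v₂ then 1 else 0) := by
    split_ifs with h
    · rw [hQ, ← h, ← hP, mul_one, eigenProj_mul_self]
    · rw [eigenProj_mul_eq_zero hV h, mul_zero, mul_zero, tr, map_zero]
  have hQP : tr (T * (Q * P)) = tr (T * P) * (if v₁ = v₂ then 1 else 0) := by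
    split_ifs with h
    · rw [hQ, ← h, ← hP, mul_one, eigenProj_mul_self]
    · rw [eigenProj_mul_eq_zero hV (Ne.symm h), mul_zero, mul_zero, tr, map_zero]
  have hTtr : (tr T).re = m := rfl
  have hexp : (1 + a₂ • Q) * (1 + star a₁ • P) * T * (1 + a₁ • P) * (1 + star a₂ • Q)
      = T + (Z' + Y') * T + T * (Z + Y) + (star a₁ * a₁) • (P * (T * P))
        + (star a₁ * star a₂) • (P * (T * Q)) + (a₂ * a₁) • (Q * (T * P))
        + (a₂ * star a₂) • (Q * (T * Q)) + B := by
    simp only [Z, Z', Y, Y', B, mul_add, add_mul, one_mul, mul_one, smul_mul_assoc, mul_smul_comm,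
      smul_add, smul_smul, mul_assoc]
    module
  have hfirst : ∀ A : E →ₗ[ℂ] E, T * (T * A) = T * A := fun A => by rw [← mul_assoc, hTT]
  rw [hexp]
  simp only [mul_add T, tr_add, hfirst, hcyc, hTT, mul_smul_comm, tr_smul, hTPTP, hTPTQ, hTQTP,
    hTQTQ, Z, Z', Y, Y', hPQ, hQP]
  have hPm : tr (T * P) = ((m * condProb V Wt v₁ w : ℝ) : ℂ) :=
    tr_eigenProj_mul_eigenProj v₁ hm0.ne'
  have hQm : tr (T * Q) = ((m * condProb V Wt v₂ w : ℝ) : ℂ) :=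
    tr_eigenProj_mul_eigenProj v₂ hm0.ne'
  have r12 := Complex.conj_eq_iff_im.1 (star_quasiprob (V := V) (Wt := Wt) v₁ v₂ w)
  have hd : (if v₁ = v₂ then (1 : ℂ) else 0) = (((if v₁ = v₂ then 1 else 0 : ℝ)) : ℂ) := by
    split_ifs <;> simp
  rw [hPm, hQm, linearTerm, quadraticTerm, ← hmdef, hd]
  have hn1 : ‖a₁‖ ^ 2 = a₁.re * a₁.re + a₁.im * a₁.im := by
    rw [← Complex.normSq_eq_norm_sq, Complex.normSq_apply]
  have hn2 : ‖a₂‖ ^ 2 = a₂.re * a₂.re + a₂.im * a₂.im := by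
    rw [← Complex.normSq_eq_norm_sq, Complex.normSq_apply]
  rw [hn1, hn2]
  generalize (if v₁ = v₂ then (1 : ℝ) else 0) = d
  simp only [Complex.add_re, Complex.mul_re, Complex.mul_im, Complex.ofReal_re, Complex.ofReal_im,
    Complex.star_def, Complex.conj_re, Complex.conj_im, hTtr, r12]
  field_simp
  ring

lemma overlapTrace_kraus {v₁ v₂ : ℂ} {p₁ p₂ : ℝ} (h₁ : 0 ≤ p₁) (h₂ : 0 ≤ p₂) (a₁ a₂ w : ℂ) :
    (tr (eigenProj Wt w * weakKraus (eigenProj V v₂) p₂ ((√p₂ : ℝ) * a₂) *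
      (weakKraus (eigenProj V v₁) p₁ ((√p₁ : ℝ) * a₁)).adjoint * eigenProj Wt w *
      weakKraus (eigenProj V v₁) p₁ ((√p₁ : ℝ) * a₁) *
      (weakKraus (eigenProj V v₂) p₂ ((√p₂ : ℝ) * a₂)).adjoint)).re
    = p₁ * p₂ * (tr (eigenProj Wt w * ((1 + a₂ • eigenProj V v₂) *
        (1 + star a₁ • eigenProj V v₁) * eigenProj Wt w * (1 + a₁ • eigenProj V v₁) *
        (1 + star a₂ • eigenProj V v₂)))).re := by
  rw [weakKraus_adjoint_apply, weakKraus_adjoint_apply, star_mul', star_mul']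
  simp only [Complex.star_def, Complex.conj_ofReal, weakKraus_eq_smul, smul_mul_assoc,
    mul_smul_comm, smul_smul, tr_smul, mul_assoc]
  rw [← Complex.re_ofReal_mul, ← Complex.re_ofReal_mul]
  congr 1
  have e1 : (((√p₁ : ℝ) : ℂ)) * ((√p₁ : ℝ) : ℂ) = (p₁ : ℂ) := by
    rw [← Complex.ofReal_mul, Real.mul_self_sqrt h₁]
  have e2 : (((√p₂ : ℝ) : ℂ)) * ((√p₂ : ℝ) : ℂ) = (p₂ : ℂ) := by
    rw [← Complex.ofReal_mul, Real.mul_self_sqrt h₂]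
  rw [← e1, ← e2]
  ring

lemma abs_log_one_add_sub_le {l q x ε : ℝ} (hε0 : 0 ≤ ε) (hε : ε ≤ 1 / 100) (hl : |l| ≤ 4 * ε)
    (hq : |q| ≤ 6 * ε ^ 2) (hx : |x| ≤ 5 * ε ^ 3) :
    0 < 1 + l + q + x ∧ |Real.log (1 + l + q + x) - (l + q - l ^ 2 / 2)| ≤ 300 * ε ^ 3 := by
  have h2 : ε ^ 2 ≤ ε / 100 := by nlinarith
  have h3 : ε ^ 3 ≤ ε ^ 2 / 100 := by nlinarith [sq_nonneg ε]
  set y := l + q + x with hy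
  have hyle : |y| ≤ 5 * ε := by
    refine (abs_add_three l q x).trans ?_
    linarith
  have hy1 : |-y| < 1 := by rw [abs_neg]; linarith
  have hlog := Real.abs_log_sub_add_sum_range_le hy1 2
  simp only [Finset.sum_range_succ, Finset.sum_range_zero, abs_neg, sub_neg_eq_add] at hlog
  -- Here `(5ε)³ = 125ε³`, and `1 - |y| ≥ 1/2` at most doubles it. With the `40ε³` below and `5ε³`
  -- for `x` the total stays under `300ε³`.
  have hrem : |y| ^ (2 + 1) / (1 - |y|) ≤ 250 * ε ^ 3 := by
    rw [div_le_iff₀ (by linarith)]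
    have : |y| ^ 3 ≤ (5 * ε) ^ 3 := by gcongr
    have hε3 : 0 ≤ ε ^ 3 := by positivity
    norm_num
    nlinarith
  have hd : |y ^ 2 / 2 - l ^ 2 / 2| ≤ 40 * ε ^ 3 := by
    rw [show y ^ 2 / 2 - l ^ 2 / 2 = (q + x) * (y + l) / 2 by rw [hy]; ring, abs_div, abs_mul,
      abs_two]
    have e1 : |q + x| ≤ 7 * ε ^ 2 := (abs_add_le _ _).trans (by linarith [sq_nonneg ε])
    have e2 : |y + l| ≤ 9 * ε := (abs_add_le _ _).trans (by linarith)
    have := mul_le_mul e1 e2 (abs_nonneg _) (by positivity)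
    nlinarith [pow_nonneg hε0 3]
  have hpos : 0 < 1 + y := by
    have := (abs_le.1 hyle).1
    linarith
  rw [show 1 + l + q + x = 1 + y by rw [hy]; ring]
  refine ⟨hpos, ?_⟩
  have hlog' := hlog.trans hrem
  norm_num at hlog'
  rw [abs_le] at *
  constructor
  · linarith [hlog'.1, hd.1, hx.1, pow_nonneg hε0 3]
  · linarith [hlog'.2, hd.2, hx.2, pow_nonneg hε0 3]

end Expansion

end

section

variable {E : Type*} [NormedAddCommGroup E] [InnerProductSpace ℂ E] [FiniteDimensional ℂ E]

section Measurement

lemma WeakMeasurement.nonempty {J : Type*} [Fintype J] {P : E →ₗ[ℂ] E} (M : WeakMeasurement J P) :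
    Nonempty J := by
  by_contra h
  rw [not_nonempty_iff] at h
  simpa using M.p_sum

variable {J : Type*} [Fintype J] {P : E →ₗ[ℂ] E} (M : WeakMeasurement J P)

/-- The coupling of an outcome relative to the square root of its uncoupled probability. -/
def WeakMeasurement.ratio (j : J) : ℂ := M.g j / (√(M.p j) : ℝ)

lemma WeakMeasurement.g_eq (j : J) : M.g j = (√(M.p j) : ℝ) * M.ratio j := by
  rw [ratio, mul_div_cancel₀]
  exact_mod_cast (Real.sqrt_pos.2 (M.p_pos j)).ne'

lemma WeakMeasurement.norm_ratio_le {ε : ℝ} {j : J} (h : ‖M.g j‖ ≤ ε * √(M.p j)) :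
    ‖M.ratio j‖ ≤ ε := by
  have := Real.sqrt_pos.2 (M.p_pos j)
  rwa [ratio, norm_div, Complex.norm_of_nonneg this.le, div_le_iff₀ this]

lemma WeakMeasurement.normBound_kraus (hP : NormBound P 1) {ε : ℝ} {j : J}
    (h : ‖M.g j‖ ≤ ε * √(M.p j)) : NormBound (M.kraus j) (√(M.p j) * (1 + ε)) := by
  rw [kraus, M.g_eq, weakKraus_eq_smul]
  refine ((NormBound.one.add (hP.smul (M.norm_ratio_le h))).smul (D := √(M.p j)) ?_).mono
    (by simp)
  rw [Complex.norm_of_nonneg (Real.sqrt_nonneg _)]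

end Measurement

/-! ### Operator norms against effective overlaps -/

section Bounds

variable {V Wt : E →ₗ[ℂ] E} {J₁ J₂ : Type*} [Fintype J₁] [Fintype J₂]
  {v₁ v₂ : Module.End.Eigenvalues V}
  {M₁ : WeakMeasurement J₁ (eigenProj V v₁)} {M₂ : WeakMeasurement J₂ (eigenProj V v₂)}

/-- The overlap `2 ^ (-b)` that corresponds to the term `b` of the bound for `w₁ = w₂ = w`. -/
def effectiveOverlap (Wt : E →ₗ[ℂ] E) (M₁ : WeakMeasurement J₁ (eigenProj V v₁))
    (M₂ : WeakMeasurement J₂ (eigenProj V v₂)) (j₁ : J₁) (j₂ : J₂) (w : ℂ) (r : ℝ) : ℝ :=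
  M₁.p j₁ * M₂.p j₂ * multiplicity Wt w *
    Real.exp (-(Real.log 2 *
      (couplingTerms V Wt v₁ v₂ (M₁.p j₁) (M₂.p j₂) (M₁.g j₁) (M₂.g j₂) w w + r)))

lemma effectiveOverlap_pos (j₁ : J₁) (j₂ : J₂) (w : Module.End.Eigenvalues Wt) (r : ℝ) :
    0 < effectiveOverlap Wt M₁ M₂ j₁ j₂ w r := by
  have h1 := M₁.p_pos j₁
  have h2 := M₂.p_pos j₂
  have h3 := one_le_multiplicity w
  unfold effectiveOverlap
  positivity

lemma boundTerm_self (j₁ : J₁) (j₂ : J₂) (w : Module.End.Eigenvalues Wt) (r : ℝ) :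
    boundTerm Wt M₁ M₂ j₁ j₂ w w r
      = ((-Real.logb 2 (effectiveOverlap Wt M₁ M₂ j₁ j₂ w r) : ℝ) : EReal) := by
  have h1 := M₁.p_pos j₁
  have h2 := M₂.p_pos j₂
  have h3 := one_le_multiplicity w
  have hl : Real.log 2 ≠ 0 := (Real.log_pos one_lt_two).ne'
  rw [boundTerm, C₀, if_pos rfl, ← EReal.coe_add, effectiveOverlap,
    Real.logb_mul (by positivity) (Real.exp_pos _).ne', Real.logb, Real.logb, Real.log_exp,
    neg_div, mul_div_cancel_left₀ _ hl]
  congr 1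
  ring

lemma nonempty_eigenvalues (hW : Wt.IsSymmetric) {ρ : E →ₗ[ℂ] E} (hρ : IsState ρ) :
    Nonempty (Module.End.Eigenvalues Wt) := by
  by_contra h
  rw [not_nonempty_iff] at h
  have h1 := sum_eigenProj hW
  rw [Finset.univ_eq_empty, Finset.sum_empty] at h1
  have h2 := hρ.2
  rw [← mul_one ρ, ← h1, mul_zero, tr, map_zero] at h2
  exact zero_ne_one h2

/-- The largest effective overlap serves as the constant `c`, and its `-log₂` is one of the terms of
the infimum. The dominating indices `i₁`, `i₂`, `w` need not be those of the outcome pair. -/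
lemma uncertaintyRelations_of_normBound (hW : Wt.IsSymmetric) {ρ : E →ₗ[ℂ] E} (hρ : IsState ρ)
    (R : J₁ → J₂ → Module.End.Eigenvalues Wt → Module.End.Eigenvalues Wt → ℝ)
    (h : ∀ j₁ j₂ (w₁ w₂ : Module.End.Eigenvalues Wt), ∃ i₁ i₂, ∃ w : Module.End.Eigenvalues Wt,
      NormBound (eigenProj Wt w₁ * M₁.kraus j₁ * (eigenProj Wt w₂ * M₂.kraus j₂))
        (√(effectiveOverlap Wt M₁ M₂ i₁ i₂ w (R i₁ i₂ w w)))) :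
    UncertaintyRelations Wt M₁ M₂ ρ (bound Wt M₁ M₂ R) := by
  have := M₁.nonempty
  have := M₂.nonempty
  have := nonempty_eigenvalues hW hρ
  obtain ⟨⟨k₁, k₂, w₀⟩, hmax⟩ := Finite.exists_max
    fun x : J₁ × J₂ × Module.End.Eigenvalues Wt =>
      effectiveOverlap Wt M₁ M₂ x.1 x.2.1 x.2.2 (R x.1 x.2.1 x.2.2 x.2.2)
  have hle : bound Wt M₁ M₂ R ≤ ((-Real.logb 2
      (effectiveOverlap Wt M₁ M₂ k₁ k₂ w₀ (R k₁ k₂ w₀ w₀)) : ℝ) : EReal) := by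
    rw [← boundTerm_self]
    exact (iInf_le _ k₁).trans ((iInf_le _ k₂).trans ((iInf_le _ w₀).trans (iInf_le _ w₀)))
  have key : ∀ (x : J₁ × Module.End.Eigenvalues Wt) (y : Module.End.Eigenvalues Wt × J₂) φ,
      ‖forwardKraus Wt M₁ x ((reverseKraus Wt M₂ y).adjoint φ)‖
        ≤ √(effectiveOverlap Wt M₁ M₂ k₁ k₂ w₀ (R k₁ k₂ w₀ w₀)) * ‖φ‖ := by
    rintro ⟨j₁, w₁⟩ ⟨w₂, j₂⟩
    obtain ⟨i₁, i₂, w, hb⟩ := h j₁ j₂ w₁ w₂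
    rw [reverseKraus, LinearMap.adjoint_adjoint]
    exact hb.mono (Real.sqrt_le_sqrt (hmax (i₁, i₂, w)))
  classical
  have hc := effectiveOverlap_pos (M₁ := M₁) (M₂ := M₂) k₁ k₂ w₀ (R k₁ k₂ w₀ w₀)
  constructor
  · refine hle.trans (EReal.coe_le_coe_iff.2 ?_)
    exact (entropic_uncertainty (sum_forwardKraus hW M₁) (sum_reverseKraus hW M₂) hρ hc key).1
  · intro α β hαβ
    refine hle.trans (EReal.coe_le_coe_iff.2 ?_)
    exact (entropic_uncertainty (sum_forwardKraus hW M₁) (sum_reverseKraus hW M₂) hρ hc key).2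
      α β hαβ

variable {ε : ℝ}

lemma effectiveOverlap_eq (j₁ : J₁) (j₂ : J₂) (w : Module.End.Eigenvalues Wt) (r : ℝ) :
    effectiveOverlap Wt M₁ M₂ j₁ j₂ w r = M₁.p j₁ * M₂.p j₂ * multiplicity Wt w *
      Real.exp (linearTerm V Wt v₁ v₂ (M₁.ratio j₁) (M₂.ratio j₂) w
        + quadraticTerm V Wt v₁ v₂ (M₁.ratio j₁) (M₂.ratio j₂) w
        - linearTerm V Wt v₁ v₂ (M₁.ratio j₁) (M₂.ratio j₂) w ^ 2 / 2 - Real.log 2 * r) := by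
  have h3 := one_le_multiplicity w
  have h := log_two_mul_couplingTerms V Wt v₁ v₂ (M₁.ratio j₁) (M₂.ratio j₂) w (M₁.p_pos j₁)
    (M₂.p_pos j₂) (by positivity)
  rw [effectiveOverlap, M₁.g_eq, M₂.g_eq, mul_add, h]
  congr 2
  ring

/-- The exponent is at least `-(4ε + 6ε² + 8ε² + ε)`, which exceeds `-0.06` for `ε ≤ 1/100`; then
`exp t ≥ 1 + t`. -/
lemma le_effectiveOverlap {j₁ : J₁} {j₂ : J₂} (w : Module.End.Eigenvalues Wt) {r : ℝ}
    (hε : ε ≤ 1 / 100) (h₁ : ‖M₁.g j₁‖ ≤ ε * √(M₁.p j₁)) (h₂ : ‖M₂.g j₂‖ ≤ ε * √(M₂.p j₂))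
    (hr : r ≤ ε) :
    M₁.p j₁ * M₂.p j₂ * multiplicity Wt w * (94 / 100)
      ≤ effectiveOverlap Wt M₁ M₂ j₁ j₂ w r := by
  have hm := one_le_multiplicity w
  have h1 := M₁.norm_ratio_le h₁
  have h2 := M₂.norm_ratio_le h₂
  have hε0 : 0 ≤ ε := (norm_nonneg _).trans h1
  have hl := abs_linearTerm_le (V := V) v₁ v₂ hm h1 h2
  have hq := abs_quadraticTerm_le (V := V) v₁ v₂ hm h1 h2
  have hp1 := M₁.p_pos j₁
  have hp2 := M₂.p_pos j₂
  rw [effectiveOverlap_eq]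
  gcongr
  refine le_trans ?_ (Real.add_one_le_exp _)
  have hl2 : linearTerm V Wt v₁ v₂ (M₁.ratio j₁) (M₂.ratio j₂) w ^ 2 ≤ (4 * ε) ^ 2 :=
    sq_le_sq' (abs_le.1 hl).1 (abs_le.1 hl).2
  have hlr : Real.log 2 * r ≤ ε := by
    have hlog0 : 0 < Real.log 2 := Real.log_pos one_lt_two
    have hlog1 : Real.log 2 ≤ 1 := by linarith [Real.log_two_lt_d9]
    calc Real.log 2 * r ≤ Real.log 2 * ε := by gcongr
      _ ≤ 1 * ε := by gcongr
      _ = ε := one_mul ε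
  have h2 : ε ^ 2 ≤ ε / 100 := by nlinarith
  linarith [(abs_le.1 hl).1, (abs_le.1 hq).1]

lemma normBound_product {j₁ : J₁} {j₂ : J₂} (w₁ w₂ : ℂ)
    (h₁ : ‖M₁.g j₁‖ ≤ ε * √(M₁.p j₁)) (h₂ : ‖M₂.g j₂‖ ≤ ε * √(M₂.p j₂)) :
    NormBound (eigenProj Wt w₁ * M₁.kraus j₁ * (eigenProj Wt w₂ * M₂.kraus j₂))
      (√(M₁.p j₁ * M₂.p j₂ * (1 + ε) ^ 4)) := by
  have hε0 : 0 ≤ ε := (norm_nonneg _).trans (M₁.norm_ratio_le h₁)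
  have hk1 := M₁.normBound_kraus (NormBound.eigenProj V v₁) h₁
  have hk2 := M₂.normBound_kraus (NormBound.eigenProj V v₂) h₂
  refine ((((NormBound.eigenProj Wt w₁).mul hk1 zero_le_one).mul
    ((NormBound.eigenProj Wt w₂).mul hk2 zero_le_one) (by positivity))).mono (le_of_eq ?_)
  rw [show (1 + ε) ^ 4 = ((1 + ε) ^ 2) ^ 2 by ring,
    Real.sqrt_mul (mul_nonneg (M₁.p_pos j₁).le (M₂.p_pos j₂).le), Real.sqrt_mul (M₁.p_pos j₁).le,
    Real.sqrt_sq (by positivity)]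
  ring

/-- The norm ignores the multiplicity while the overlap is proportional to it: `1.01⁴ ≤ 2 · 0.94`.
The projectors `w₁`, `w₂` are arbitrary and unrelated to `w`, which is what the degenerate case
exploits. -/
lemma normBound_product_of_two_le_multiplicity {j₁ : J₁} {j₂ : J₂} (w₁ w₂ : ℂ)
    {w : Module.End.Eigenvalues Wt} (hm : 2 ≤ multiplicity Wt w) {r : ℝ} (hε : ε ≤ 1 / 100)
    (h₁ : ‖M₁.g j₁‖ ≤ ε * √(M₁.p j₁)) (h₂ : ‖M₂.g j₂‖ ≤ ε * √(M₂.p j₂)) (hr : r ≤ ε) :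
    NormBound (eigenProj Wt w₁ * M₁.kraus j₁ * (eigenProj Wt w₂ * M₂.kraus j₂))
      (√(effectiveOverlap Wt M₁ M₂ j₁ j₂ w r)) := by
  have hε0 : 0 ≤ ε := (norm_nonneg _).trans (M₁.norm_ratio_le h₁)
  refine (normBound_product w₁ w₂ h₁ h₂).mono (Real.sqrt_le_sqrt ?_)
  refine le_trans ?_ (le_effectiveOverlap w hε h₁ h₂ hr)
  have := mul_pos (M₁.p_pos j₁) (M₂.p_pos j₂)
  rw [mul_assoc _ (multiplicity Wt w)]
  refine mul_le_mul_of_nonneg_left ?_ this.le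
  have : (1 + ε) ^ 4 ≤ (1 + 1 / 100) ^ 4 := by gcongr
  norm_num at this ⊢
  linarith

lemma normBound_product_of_ne (hW : Wt.IsSymmetric) {j₁ : J₁} {j₂ : J₂}
    {w₁ w₂ : Module.End.Eigenvalues Wt} (hne : w₁ ≠ w₂) {r : ℝ} (hε : ε ≤ 1 / 100)
    (h₁ : ‖M₁.g j₁‖ ≤ ε * √(M₁.p j₁)) (h₂ : ‖M₂.g j₂‖ ≤ ε * √(M₂.p j₂)) (hr : r ≤ ε) :
    NormBound (eigenProj Wt w₁ * M₁.kraus j₁ * (eigenProj Wt w₂ * M₂.kraus j₂))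
      (√(effectiveOverlap Wt M₁ M₂ j₁ j₂ w₁ r)) := by
  have hε0 : 0 ≤ ε := (norm_nonneg _).trans (M₁.norm_ratio_le h₁)
  have hk2 := M₂.normBound_kraus (NormBound.eigenProj V v₂) h₂
  have hzero : eigenProj Wt w₁ * eigenProj Wt w₂ = 0 :=
    eigenProj_mul_eq_zero hW fun h => hne (Subtype.ext h)
  -- The identity part of the first weak Kraus operator is killed by `Π_{w₁} Π_{w₂} = 0`, leaving an
  -- overall factor `g`.
  have heq : eigenProj Wt w₁ * M₁.kraus j₁ * (eigenProj Wt w₂ * M₂.kraus j₂)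
      = M₁.g j₁ • (eigenProj Wt w₁ * eigenProj V v₁ * (eigenProj Wt w₂ * M₂.kraus j₂)) := by
    rw [WeakMeasurement.kraus, weakKraus]
    simp only [mul_add, add_mul, mul_smul_comm, smul_mul_assoc, mul_one]
    rw [← mul_assoc, hzero, zero_mul, smul_zero, zero_add]
  rw [heq]
  refine ((((NormBound.eigenProj Wt w₁).mul (NormBound.eigenProj V v₁) zero_le_one).mul
    ((NormBound.eigenProj Wt w₂).mul hk2 zero_le_one) (by positivity)).smul h₁).mono ?_
  rw [Real.le_sqrt (by positivity) (effectiveOverlap_pos j₁ j₂ w₁ r).le]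
  refine le_trans ?_ (le_effectiveOverlap w₁ hε h₁ h₂ hr)
  have hm := one_le_multiplicity w₁
  have hp := mul_pos (M₁.p_pos j₁) (M₂.p_pos j₂)
  have e : (ε * √(M₁.p j₁) * (1 * 1 * (1 * (√(M₂.p j₂) * (1 + ε))))) ^ 2
      = M₁.p j₁ * M₂.p j₂ * (ε * (1 + ε)) ^ 2 := by
    rw [← Real.sq_sqrt (M₁.p_pos j₁).le, ← Real.sq_sqrt (M₂.p_pos j₂).le,
      Real.sqrt_sq (Real.sqrt_nonneg _), Real.sqrt_sq (Real.sqrt_nonneg _)]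
    ring
  rw [e, mul_assoc _ (multiplicity Wt w₁)]
  refine mul_le_mul_of_nonneg_left ?_ hp.le
  have : (ε * (1 + ε)) ^ 2 ≤ (1 / 100 * (1 + 1 / 100)) ^ 2 := by gcongr
  norm_num at this ⊢
  linarith

open scoped InnerProductSpace

lemma norm_one_add_smul_eigenProj_sq (A : E →ₗ[ℂ] E) (v a : ℂ) {e : E} (he : ‖e‖ = 1) :
    ‖e + a • eigenProj A v e‖ ^ 2
      ≤ 1 + 2 * (a.re * (⟪e, eigenProj A v e⟫_ℂ).re) + ‖a‖ ^ 2 := by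
  have h0 : (⟪e, eigenProj A v e⟫_ℂ).im = 0 := by
    rw [← Complex.conj_eq_iff_im, inner_conj_symm, ← LinearMap.adjoint_inner_right,
      eigenProj_adjoint]
  have h1 : ‖eigenProj A v e‖ ≤ 1 := (norm_eigenProj_apply_le A v e).trans_eq he
  have h2 := norm_add_sq (𝕜 := ℂ) e (a • eigenProj A v e)
  rw [h2, he, inner_smul_right, norm_smul, mul_pow]
  simp only [RCLike.re_to_complex, Complex.mul_re, h0, mul_zero, sub_zero]
  have : ‖a‖ ^ 2 * ‖eigenProj A v e‖ ^ 2 ≤ ‖a‖ ^ 2 * 1 ^ 2 := by gcongr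
  linarith

/-- With `Π_w = |e⟩⟨e|` the norm is `|⟪e, K₁ e⟫| ‖K₂† e‖`. Its square matches the overlap to first
order but in general not to second, hence the remainder of order `ε²`. -/
lemma normBound_product_of_multiplicity_eq_one {j₁ : J₁} {j₂ : J₂}
    {w : Module.End.Eigenvalues Wt} (hm : multiplicity Wt w = 1)
    (h₁ : ‖M₁.g j₁‖ ≤ ε * √(M₁.p j₁)) (h₂ : ‖M₂.g j₂‖ ≤ ε * √(M₂.p j₂)) :
    NormBound (eigenProj Wt w * M₁.kraus j₁ * (eigenProj Wt w * M₂.kraus j₂))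
      (√(effectiveOverlap Wt M₁ M₂ j₁ j₂ w (-(1000 * ε ^ 2)))) := by
  obtain ⟨e, he, hproj, htr⟩ := exists_eigenvector_of_multiplicity_eq_one hm
  have n1 := M₁.norm_ratio_le h₁
  have n2 := M₂.norm_ratio_le h₂
  have hε0 : 0 ≤ ε := (norm_nonneg _).trans n1
  have hp1 := M₁.p_pos j₁
  have hp2 := M₂.p_pos j₂
  have hl := abs_linearTerm_le (V := V) v₁ v₂ hm.ge n1 n2
  have hq := abs_quadraticTerm_le (V := V) v₁ v₂ hm.ge n1 n2
  have hcond : ∀ v, condProb V Wt v w = (⟪e, eigenProj V v e⟫_ℂ).re := by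
    intro v
    rw [condProb, hm, div_one, tr_mul_comm, htr]
  set a₁ := M₁.ratio j₁ with ha₁
  set a₂ := M₂.ratio j₂ with ha₂
  have k1 : ‖⟪e, M₁.kraus j₁ e⟫_ℂ‖ ≤ √(M₁.p j₁) * ‖e + a₁ • eigenProj V v₁ e‖ := by
    rw [WeakMeasurement.kraus, M₁.g_eq, weakKraus_eq_smul, LinearMap.smul_apply, inner_smul_right,
      norm_mul, Complex.norm_of_nonneg (Real.sqrt_nonneg _)]
    gcongr
    refine (norm_inner_le_norm _ _).trans_eq ?_
    rw [he, one_mul]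
    rfl
  have k2 : ‖(M₂.kraus j₂).adjoint e‖ = √(M₂.p j₂) * ‖e + star a₂ • eigenProj V v₂ e‖ := by
    rw [WeakMeasurement.kraus, M₂.g_eq, weakKraus_adjoint_apply, star_mul', Complex.star_def,
      Complex.conj_ofReal, weakKraus_eq_smul, LinearMap.smul_apply, norm_smul,
      Complex.norm_of_nonneg (Real.sqrt_nonneg _)]
    rfl
  have s1 := norm_one_add_smul_eigenProj_sq V v₁ a₁ he
  have s2 := norm_one_add_smul_eigenProj_sq V v₂ (star a₂) he
  rw [← hcond] at s1 s2
  rw [norm_star, show (star a₂).re = a₂.re from rfl] at s2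
  have n1' : ‖a₁‖ ^ 2 ≤ ε ^ 2 := by gcongr
  have n2' : ‖a₂‖ ^ 2 ≤ ε ^ 2 := by gcongr
  have t1 : ‖e + a₁ • eigenProj V v₁ e‖ ^ 2
      ≤ Real.exp (2 * (a₁.re * condProb V Wt v₁ w) + ε ^ 2) :=
    le_trans (by linarith) (Real.add_one_le_exp _)
  have t2 : ‖e + star a₂ • eigenProj V v₂ e‖ ^ 2
      ≤ Real.exp (2 * (a₂.re * condProb V Wt v₂ w) + ε ^ 2) :=
    le_trans (by linarith) (Real.add_one_le_exp _)
  have hfinal : √(M₁.p j₁) * ‖e + a₁ • eigenProj V v₁ e‖ *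
      (√(M₂.p j₂) * ‖e + star a₂ • eigenProj V v₂ e‖)
      ≤ √(effectiveOverlap Wt M₁ M₂ j₁ j₂ w (-(1000 * ε ^ 2))) := by
    rw [Real.le_sqrt (by positivity) (effectiveOverlap_pos j₁ j₂ w _).le, effectiveOverlap_eq, hm,
      mul_one, ← ha₁, ← ha₂]
    have e1 : (√(M₁.p j₁) * ‖e + a₁ • eigenProj V v₁ e‖ *
        (√(M₂.p j₂) * ‖e + star a₂ • eigenProj V v₂ e‖)) ^ 2
        = M₁.p j₁ * M₂.p j₂ * (‖e + a₁ • eigenProj V v₁ e‖ ^ 2 *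
          ‖e + star a₂ • eigenProj V v₂ e‖ ^ 2) := by
      rw [mul_pow, mul_pow, mul_pow, Real.sq_sqrt hp1.le, Real.sq_sqrt hp2.le]
      ring
    rw [e1]
    gcongr
    refine (mul_le_mul t1 t2 (sq_nonneg _) (Real.exp_pos _).le).trans ?_
    rw [← Real.exp_add]
    apply Real.exp_le_exp.2
    have hl2 : linearTerm V Wt v₁ v₂ a₁ a₂ w ^ 2 ≤ (4 * ε) ^ 2 :=
      sq_le_sq' (abs_le.1 hl).1 (abs_le.1 hl).2
    have hlin : linearTerm V Wt v₁ v₂ a₁ a₂ w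
      = 2 * (a₁.re * condProb V Wt v₁ w) + 2 * (a₂.re * condProb V Wt v₂ w) := by
      rw [linearTerm, mul_add]
    -- The remainder adds at least `500ε²` to the exponent, against at most `2ε² + 6ε² + 8ε²` of
    -- second-order terms.
    have hlog : 1 / 2 * (1000 * ε ^ 2) ≤ Real.log 2 * (1000 * ε ^ 2) := by
      gcongr
      linarith [Real.log_two_gt_d9]
    linarith [(abs_le.1 hq).1, sq_nonneg ε]
  intro φ
  have hφ : (eigenProj Wt w * M₁.kraus j₁ * (eigenProj Wt w * M₂.kraus j₂)) φ
      = (⟪(M₂.kraus j₂).adjoint e, φ⟫_ℂ * ⟪e, M₁.kraus j₁ e⟫_ℂ) • e := by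
    simp only [Module.End.mul_apply]
    rw [hproj (M₂.kraus j₂ φ), map_smul, map_smul, hproj, smul_smul, LinearMap.adjoint_inner_left]
  rw [hφ, norm_smul, he, mul_one, norm_mul]
  calc ‖⟪(M₂.kraus j₂).adjoint e, φ⟫_ℂ‖ * ‖⟪e, M₁.kraus j₁ e⟫_ℂ‖
      ≤ (‖(M₂.kraus j₂).adjoint e‖ * ‖φ‖) * (√(M₁.p j₁) * ‖e + a₁ • eigenProj V v₁ e‖) := by
        gcongr
        exact norm_inner_le_norm _ _
    _ = √(M₁.p j₁) * ‖e + a₁ • eigenProj V v₁ e‖ *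
        (√(M₂.p j₂) * ‖e + star a₂ • eigenProj V v₂ e‖) * ‖φ‖ := by rw [k2]; ring
    _ ≤ _ := by gcongr

/-- The difference between the logarithm of the overlap trace and its second-order expansion. -/
def overlapRemainder (Wt : E →ₗ[ℂ] E) (M₁ : WeakMeasurement J₁ (eigenProj V v₁))
    (M₂ : WeakMeasurement J₂ (eigenProj V v₂)) (j₁ : J₁) (j₂ : J₂)
    (w : Module.End.Eigenvalues Wt) : ℝ :=
  -Real.logb 2 (overlapTrace Wt M₁ M₂ j₁ j₂ w w)
    + Real.logb 2 (effectiveOverlap Wt M₁ M₂ j₁ j₂ w 0)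

lemma boundTerm_overlapRemainder (j₁ : J₁) (j₂ : J₂) (w : Module.End.Eigenvalues Wt) :
    boundTerm Wt M₁ M₂ j₁ j₂ w w (overlapRemainder Wt M₁ M₂ j₁ j₂ w)
      = ((-Real.logb 2 (overlapTrace Wt M₁ M₂ j₁ j₂ w w) : ℝ) : EReal) := by
  have h0 := effectiveOverlap_pos (M₁ := M₁) (M₂ := M₂) j₁ j₂ w 0
  have hl : Real.log 2 ≠ 0 := (Real.log_pos one_lt_two).ne'
  have h : ∀ r, Real.logb 2 (effectiveOverlap Wt M₁ M₂ j₁ j₂ w r)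
      = Real.logb 2 (effectiveOverlap Wt M₁ M₂ j₁ j₂ w 0) - r := by
    intro r
    have e : effectiveOverlap Wt M₁ M₂ j₁ j₂ w r
        = effectiveOverlap Wt M₁ M₂ j₁ j₂ w 0 * Real.exp (-(Real.log 2 * r)) := by
      rw [effectiveOverlap, effectiveOverlap, mul_assoc _ (Real.exp _), ← Real.exp_add]
      congr 2
      ring
    rw [e, Real.logb_mul h0.ne' (Real.exp_pos _).ne', Real.logb, Real.logb, Real.log_exp, neg_div,
      mul_div_cancel_left₀ _ hl]
    ring
  rw [boundTerm_self, h, overlapRemainder]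
  congr 1
  ring

lemma abs_overlapRemainder_le (hV : V.IsSymmetric) {j₁ : J₁} {j₂ : J₂}
    (w : Module.End.Eigenvalues Wt) (hε : ε ≤ 1 / 100)
    (h₁ : ‖M₁.g j₁‖ ≤ ε * √(M₁.p j₁)) (h₂ : ‖M₂.g j₂‖ ≤ ε * √(M₂.p j₂)) :
    |overlapRemainder Wt M₁ M₂ j₁ j₂ w| ≤ 1000 * ε ^ 3 := by
  have n1 := M₁.norm_ratio_le h₁
  have n2 := M₂.norm_ratio_le h₂
  have hε0 : 0 ≤ ε := (norm_nonneg _).trans n1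
  have hm := one_le_multiplicity w
  have hp1 := M₁.p_pos j₁
  have hp2 := M₂.p_pos j₂
  have hl := abs_linearTerm_le (V := V) v₁ v₂ hm n1 n2
  have hq := abs_quadraticTerm_le (V := V) v₁ v₂ hm n1 n2
  obtain ⟨x, hx, htr⟩ := exists_tr_overlap_eq hV v₁ v₂ hm n1 n2 (by linarith)
  obtain ⟨hpos, hlog⟩ := abs_log_one_add_sub_le hε0 hε hl hq hx
  have htrace : overlapTrace Wt M₁ M₂ j₁ j₂ w w = M₁.p j₁ * M₂.p j₂ * multiplicity Wt w *
      (1 + linearTerm V Wt v₁ v₂ (M₁.ratio j₁) (M₂.ratio j₂) w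
        + quadraticTerm V Wt v₁ v₂ (M₁.ratio j₁) (M₂.ratio j₂) w + x) := by
    rw [overlapTrace, WeakMeasurement.kraus, WeakMeasurement.kraus, M₁.g_eq, M₂.g_eq,
      overlapTrace_kraus hp1.le hp2.le, htr, mul_assoc, mul_assoc, mul_assoc]
  have hlog2 : 1 / 2 < Real.log 2 := by linarith [Real.log_two_gt_d9]
  rw [overlapRemainder, htrace, effectiveOverlap_eq, Real.logb, Real.logb,
    Real.log_mul (by positivity) hpos.ne', Real.log_mul (by positivity) (Real.exp_pos _).ne',
    Real.log_exp, mul_zero, sub_zero, ← neg_div, ← add_div, abs_div,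
    abs_of_pos (by linarith : (0 : ℝ) < Real.log 2), div_le_iff₀ (by linarith)]
  rw [abs_sub_comm] at hlog
  calc _ = _ := by congr 1; ring
    _ ≤ 300 * ε ^ 3 := hlog
    _ ≤ 1000 * ε ^ 3 * (1 / 2) := by nlinarith [pow_nonneg hε0 3]
    _ ≤ _ := by gcongr

lemma uncertaintyRelations_second_order (hW : Wt.IsSymmetric) {ρ : E →ₗ[ℂ] E} (hρ : IsState ρ)
    (hε : ε ≤ 1 / 100) (h₁ : ∀ j, ‖M₁.g j‖ ≤ ε * √(M₁.p j))
    (h₂ : ∀ j, ‖M₂.g j‖ ≤ ε * √(M₂.p j)) :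
    UncertaintyRelations Wt M₁ M₂ ρ (bound Wt M₁ M₂ fun _ _ _ _ => -(1000 * ε ^ 2)) := by
  refine uncertaintyRelations_of_normBound hW hρ _ fun j₁ j₂ w₁ w₂ => ⟨j₁, j₂, w₁, ?_⟩
  have hε0 : 0 ≤ ε := (norm_nonneg _).trans (M₁.norm_ratio_le (h₁ j₁))
  have hr : -(1000 * ε ^ 2) ≤ ε := by nlinarith [sq_nonneg ε]
  by_cases hw : w₁ = w₂
  · subst hw
    by_cases hm : Module.finrank ℂ (Module.End.eigenspace Wt w₁) = 1
    · exact normBound_product_of_multiplicity_eq_one (by rw [multiplicity_eq, hm, Nat.cast_one])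
        (h₁ j₁) (h₂ j₂)
    · refine normBound_product_of_two_le_multiplicity _ _ ?_ hε (h₁ j₁) (h₂ j₂) hr
      have := one_le_multiplicity w₁
      rw [multiplicity_eq] at this ⊢
      have h1 : 1 ≤ Module.finrank ℂ (Module.End.eigenspace Wt w₁) := by exact_mod_cast this
      have h2 : 2 ≤ Module.finrank ℂ (Module.End.eigenspace Wt w₁) := by omega
      exact_mod_cast h2
  · exact normBound_product_of_ne hW hw hε (h₁ j₁) (h₂ j₂) hr

/-- One degenerate eigenvalue `w` dominates all outcome pairs with the same `j₁`, `j₂`, so the only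
requirement on `R` is that it not be large. -/
lemma uncertaintyRelations_of_isDegenerate (hW : Wt.IsSymmetric) (hdeg : IsDegenerate Wt)
    {ρ : E →ₗ[ℂ] E} (hρ : IsState ρ) (hε : ε ≤ 1 / 100) (h₁ : ∀ j, ‖M₁.g j‖ ≤ ε * √(M₁.p j))
    (h₂ : ∀ j, ‖M₂.g j‖ ≤ ε * √(M₂.p j))
    (R : J₁ → J₂ → Module.End.Eigenvalues Wt → Module.End.Eigenvalues Wt → ℝ)
    (hR : ∀ j₁ j₂ w₁ w₂, R j₁ j₂ w₁ w₂ ≤ ε) :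
    UncertaintyRelations Wt M₁ M₂ ρ (bound Wt M₁ M₂ R) := by
  obtain ⟨w, hw⟩ := hdeg
  have hev : Module.End.HasEigenvalue Wt w := by
    refine Module.End.hasEigenvalue_iff.2 fun h => ?_
    rw [h, finrank_bot] at hw
    omega
  refine uncertaintyRelations_of_normBound hW hρ _ fun j₁ j₂ w₁ w₂ => ⟨j₁, j₂, ⟨w, hev⟩, ?_⟩
  refine normBound_product_of_two_le_multiplicity _ _ ?_ hε (h₁ j₁) (h₂ j₂) (hR _ _ _ _)
  rw [multiplicity_eq]
  exact_mod_cast hw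

end Bounds

end

end OTOC

end

theorem theorem1 :
    ∃ ε₀ K : ℝ, 0 < ε₀ ∧ 0 < K ∧
      ∀ (E : Type*) [NormedAddCommGroup E] [InnerProductSpace ℂ E] [FiniteDimensional ℂ E]
        (H V W ρ : E →ₗ[ℂ] E) (t : ℝ) (v₁ v₂ : Module.End.Eigenvalues V)
        (J₁ J₂ : Type*) [Fintype J₁] [Fintype J₂]
        (M₁ : OTOC.WeakMeasurement J₁ (OTOC.eigenProj V v₁))
        (M₂ : OTOC.WeakMeasurement J₂ (OTOC.eigenProj V v₂)) (ε : ℝ),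
        H.IsSymmetric → V.IsSymmetric → W.IsSymmetric → OTOC.IsState ρ → ε ≤ ε₀ →
        (∀ j, ‖M₁.g j‖ ≤ ε * Real.sqrt (M₁.p j)) →
        (∀ j, ‖M₂.g j‖ ≤ ε * Real.sqrt (M₂.p j)) →
        ∀ Wt : E →ₗ[ℂ] E, Wt = OTOC.heisenberg H W t →
        (∑ x, (OTOC.forwardKraus Wt M₁ x).adjoint * OTOC.forwardKraus Wt M₁ x = 1) ∧
        (∑ x, (OTOC.reverseKraus Wt M₂ x).adjoint * OTOC.reverseKraus Wt M₂ x = 1) ∧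
        (∃ R₂ : J₁ → J₂ → Module.End.Eigenvalues Wt → Module.End.Eigenvalues Wt → ℝ,
          (∀ j₁ j₂ w₁ w₂, |R₂ j₁ j₂ w₁ w₂| ≤ K * ε ^ 2) ∧
          OTOC.UncertaintyRelations Wt M₁ M₂ ρ (OTOC.bound Wt M₁ M₂ R₂)) ∧
        (∃ R₃ : J₁ → J₂ → Module.End.Eigenvalues Wt → Module.End.Eigenvalues Wt → ℝ,
          (∀ j₁ j₂ w₁ w₂, |R₃ j₁ j₂ w₁ w₂| ≤ K * ε ^ 3) ∧
          (∀ j₁ j₂ w, ((-Real.logb 2 (OTOC.overlapTrace Wt M₁ M₂ j₁ j₂ w w) : ℝ) : EReal)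
            = OTOC.boundTerm Wt M₁ M₂ j₁ j₂ w w (R₃ j₁ j₂ w w)) ∧
          (OTOC.IsDegenerate W →
            OTOC.UncertaintyRelations Wt M₁ M₂ ρ (OTOC.bound Wt M₁ M₂ R₃))) := by
  refine ⟨1 / 100, 1000, by norm_num, by norm_num, ?_⟩
  intro E _ _ _ H V W ρ t v₁ v₂ J₁ J₂ _ _ M₁ M₂ ε hH hV hW hρ hε h₁ h₂ Wt hWt
  have hWs : Wt.IsSymmetric := hWt ▸ OTOC.heisenberg_isSymmetric H hW t
  have hε0 : 0 ≤ ε := by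
    obtain ⟨j⟩ := M₁.nonempty
    exact (norm_nonneg _).trans (M₁.norm_ratio_le (h₁ j))
  have hR : ∀ j₁ j₂ w, |OTOC.overlapRemainder Wt M₁ M₂ j₁ j₂ w| ≤ 1000 * ε ^ 3 :=
    fun j₁ j₂ w => OTOC.abs_overlapRemainder_le hV w hε (h₁ j₁) (h₂ j₂)
  refine ⟨OTOC.sum_forwardKraus hWs M₁, OTOC.sum_reverseKraus hWs M₂,
    ⟨_, fun _ _ _ _ => ?_, OTOC.uncertaintyRelations_second_order hWs hρ hε h₁ h₂⟩,
    ⟨fun j₁ j₂ _ w => OTOC.overlapRemainder Wt M₁ M₂ j₁ j₂ w, fun j₁ j₂ _ w => hR j₁ j₂ w,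
      fun j₁ j₂ w => (OTOC.boundTerm_overlapRemainder j₁ j₂ w).symm, fun hdeg => ?_⟩⟩
  · rw [abs_neg, abs_of_nonneg (by positivity)]
  · refine OTOC.uncertaintyRelations_of_isDegenerate hWs
      (hWt ▸ OTOC.isDegenerate_heisenberg hH t hdeg) hρ hε h₁ h₂ _ fun j₁ j₂ _ w => ?_
    refine (le_abs_self _).trans ((hR j₁ j₂ w).trans ?_)
    -- For `ε ≤ 1/100` one has `1000ε³ ≤ ε / 10`.
    nlinarith [mul_nonneg hε0 hε0, mul_nonneg hε0 (mul_nonneg hε0 (sub_nonneg.2 hε))]
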